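/- Let $V_0>0$ and $R>0$, and for $\lambda\in\mathbb R$ consider the problem $$P(\lambda):\qquad -U''+\frac{V_0}{\sqrt U}\,\chi_{\{U>0\}}=\lambda U\ \text{ in }(-R,R),\qquad U(\pm R)=0 .$$ A nonnegative solution is a function $U\ge 0$ in $C([-R,R])\cap W^{2,1}_{\rm loc}(-R,R)$ with $U(\pm R)=0$ that satisfies the equation almost everywhere; it is nontrivial if $U\not\equiv 0$, and positive if $U>0$ on $(-R,R)$ (it is then of class $C^2$ in $(-R,R)$). Put $F(r)=\frac{r^2}{2}-2\sqrt r$, $r_F=2\sqrt[3]{2}$ (the positive zero of $F$), $$\gamma(\mu)=\frac1{\sqrt2}\int_0^\mu\frac{dr}{(F(\mu)-F(r))^{1/2}}\quad(\mu\ge r_F),\qquad \lambda_1^*=\frac1{2R^2}\left(\int_0^{r_F}\frac{dr}{(F(r_F)-F(r))^{1/2}}\right)^2 .$$ These integrals converge, and $(\frac{\pi}{2R})^2<\lambda_1^*$. Moreover: a) If $\lambda<(\frac{\pi}{2R})^2$, there is no nontrivial nonnegative solution of $P(\lambda)$; in particular there is no positive one. b) If $(\frac{\pi}{2R})^2<\lambda<\lambda_1^*$,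 there is a unique positive solution $u_{\lambda,V_0}$, and it is the only nontrivial nonnegative solution. Its outward normal derivatives at $\pm R$ exist and are negative: $u_{\lambda,V_0}'(R)<0$ and $-u_{\lambda,V_0}'(-R)<0$. There is exactly one $\mu\ge r_F$ with $\gamma(\mu)=\sqrt\lambda R$, denoted by $\gamma^{-1}(\sqrt\lambda R)$, and $$\|u_{\lambda,V_0}\|_{L^\infty(-R,R)}=\left(\frac{V_0}{\lambda}\right)^{2/3}\gamma^{-1}(\sqrt\lambda R).$$ c) If $\lambda=\lambda_1^*$, there is a unique positive solution $u_{\lambda_1^*,V_0}$, and it is the only nontrivial nonnegative solution. It is flat, that is, $u_{\lambda_1^*,V_0}'(\pm R)=0$, and $\|u_{\lambda_1^*,V_0}\|_{L^\infty(-R,R)}=\left(\frac{4V_0}{\lambda_1^*}\right)^{2/3}$. d) Let $\lambda=\lambda_1^*\omega$ with $\omega>1$, extend $u_{\lambda_1^*,V_0}$ by zero outside $(-R,R)$, and for $z\in\mathbb R$ put $$b_z(x)=\frac1{\omega^{2/3}}\,u_{\lambda_1^*,V_0}(\sqrt\omega\,x-z).$$ The set $\{b_z>0\}$ is contained in $(-R,R)$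 if and only if $|z|\le(\sqrt\omega-1)R$. For these $z$, $b_z$ is a nonnegative solution of $P(\lambda)$ with $\{b_z>0\}=\left(\frac{z-R}{\sqrt\omega},\frac{z+R}{\sqrt\omega}\right)$, and its support is the closure of this interval. For $j\ge1$ let $S_j(\lambda)$ be the set of the sums $b_{z_1}+\dots+b_{z_j}$ such that the sets $\{b_{z_i}>0\}$ are contained in $(-R,R)$ and pairwise disjoint, and let $N=N(\lambda)=\lfloor\sqrt\omega\rfloor$. Then $S_j(\lambda)\neq\emptyset$ if and only if $j\le N$. Every $u\in S_j(\lambda)$ is a compactly supported nonnegative solution of $P(\lambda)$, the set $\{u>0\}$ has exactly $j$ connected components, and $$\|u\|_{L^\infty(-R,R)}=\frac1{\omega^{2/3}}\|u_{\lambda_1^*,V_0}\|_{L^\infty(-R,R)}=\frac1{\omega^{2/3}}\left(\frac{4V_0}{\lambda_1^*}\right)^{2/3}.$$ If $1\le j<\sqrt\omega$, there are $u\in S_j(\lambda)$ whose closed support is contained in $(-R,R)$ and has exactly $j$ connected components. Finally, the set of all nontrivial nonnegative solutions of $P(\lambda)$ (as functions on $[-R,R]$) is $S(\lambda)=\bigcup_{j=1}^{N}S_j(\lambda)$.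 -/

import Mathlib

open Set MeasureTheory
open scoped ENNReal

noncomputable section

namespace SingularEigenvalue

/-- The primitive `F(r) = r²/2 - 2√r` of `f(s) = s - 1/√s`. -/
def F (r : ℝ) : ℝ := r ^ 2 / 2 - 2 * √r

/-- The positive zero `r_F = 2 · 2^(1/3)` of `F`. -/
def rF : ℝ := 2 * (2 : ℝ) ^ (1 / 3 : ℝ)

/-- `γ(μ) = (1/√2) ∫₀^μ dr / (F(μ) - F(r))^(1/2)`, used for `μ ≥ r_F`. -/
def gamma (μ : ℝ) : ℝ := 1 / √2 * ∫ r in (0 : ℝ)..μ, 1 / √(F μ - F r)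

/-- The critical value `λ₁* = (1/(2R²)) (∫₀^{r_F} dr / (F(r_F) - F(r))^(1/2))²`. -/
def lamStar (R : ℝ) : ℝ :=
  1 / (2 * R ^ 2) * (∫ r in (0 : ℝ)..rF, 1 / √(F rF - F r)) ^ 2

/-- The singular absorption term `(V₀ / √U) χ_{U > 0}`. -/
def absorption (V₀ : ℝ) (U : ℝ → ℝ) (x : ℝ) : ℝ :=
  if 0 < U x then V₀ / √(U x) else 0

/-- Nonnegative solutions of `-U'' + (V₀/√U) χ_{U > 0} = λ U` in `(-R, R)`, `U(±R) = 0`: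
`U ∈ C([-R,R])` is differentiable in `(-R,R)`, `U'` is locally absolutely continuous there
(that is, `U ∈ W^{2,1}_loc(-R,R)`), and the equation holds almost everywhere. Only the values of
`U` on `[-R, R]` matter. -/
structure IsNonnegSolution (V₀ R lam : ℝ) (U : ℝ → ℝ) : Prop where
  continuousOn : ContinuousOn U (Icc (-R) R)
  nonneg : ∀ x ∈ Icc (-R) R, 0 ≤ U x
  left_eq_zero : U (-R) = 0
  right_eq_zero : U R = 0
  differentiableAt : ∀ x ∈ Ioo (-R) R, DifferentiableAt ℝ U x
  deriv_absolutelyContinuous : ∀ a ∈ Ioo (-R) R, ∀ b ∈ Ioo (-R) R,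
    AbsolutelyContinuousOnInterval (deriv U) a b
  equation : ∀ᵐ x ∂(volume.restrict (Ioo (-R) R)),
    -deriv (deriv U) x + absorption V₀ U x = lam * U x

/-- Positive solutions: positive on the whole of `(-R, R)` (where they are then classical `C²`
solutions). -/
def IsPositiveSolution (V₀ R lam : ℝ) (U : ℝ → ℝ) : Prop :=
  IsNonnegSolution V₀ R lam U ∧ ∀ x ∈ Ioo (-R) R, 0 < U x

/-- `U` is not identically zero on `(-R, R)`. -/
def Nontrivial (R : ℝ) (U : ℝ → ℝ) : Prop := ∃ x ∈ Ioo (-R) R, U x ≠ 0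

/-- The norm of `L^∞(-R, R)`. -/
def supNorm (R : ℝ) (U : ℝ → ℝ) : ℝ≥0∞ := eLpNorm U ∞ (volume.restrict (Ioo (-R) R))

/-- The rescaled and shifted function `x ↦ ω^(-2/3) W(√ω x - z)`, where `W` has been extended by
zero outside `(-R, R)`. -/
def bump (R : ℝ) (W : ℝ → ℝ) (ω z : ℝ) (x : ℝ) : ℝ :=
  1 / ω ^ (2 / 3 : ℝ) * (Ioo (-R) R).indicator W (√ω * x - z)

/-- The family of the sums of `j` bumps, all with their positivity set inside
`(-R, R)`, these positivity sets being pairwise disjoint. -/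
def bumpFamily (R : ℝ) (W : ℝ → ℝ) (ω : ℝ) (j : ℕ) : Set (ℝ → ℝ) :=
  {u | ∃ z : Fin j → ℝ,
    (∀ i, Function.support (bump R W ω (z i)) ⊆ Ioo (-R) R) ∧
    (∀ i k, i ≠ k →
      Disjoint (Function.support (bump R W ω (z i))) (Function.support (bump R W ω (z k)))) ∧
    u = fun x => ∑ i, bump R W ω (z i) x}

end SingularEigenvalue

end

/-! On an interval where a solution is positive the equation is an autonomous second order ODE, so
the solution there is determined by its maximum `M` and the point `c` where it is attained. Writing
`U(x) = M s(√λ (x - c))` gives `s'' = k/(4√s) - s`, `s(0) = 1`, `s'(0) = 0`, with the single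
parameter `k = 4V₀/(λ M^(3/2))`. The energy identity is `s'² = 1 - s² - k(1 - √s)`. At a zero of `s`
it reads `s'² = 1 - k`, so `k ≤ 1`, and the contact with zero is flat exactly when `k = 1`.

The substitution `s = cos φ` removes the turning point: `φ'² = speedSq k (cos φ)`, and the
half-length of the positivity interval, in the rescaled variable, is `halfPeriod k`. It is
continuous and strictly increasing on `k ≤ 1`, with values `π/2` at `0` and `2π/3` at `1`; for `k =
1` the profile is `cos^(4/3)(3t/4)`. The substitution `r = μ cos φ` turns `gamma μ` into `halfPeriod
(4/μ^(3/2))`, and `rF` corresponds to `k = 1`; hence `lamStar R = (2π/(3R))²`.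

The classification rests on `IsNonnegSolution.exists_model`. Each maximal positivity interval
carries a rescaled profile. If one of its ends lies inside `(-R, R)`, that end is an interior
minimum of a differentiable function, the slope there vanishes and `k = 1`. So every arc either is
flat or fills the whole interval. Below `(π/(2R))²` every arc is too long, because `halfPeriod k >
π/2`. Up to `lamStar R` a flat arc can fit only by filling the interval, so the equation `halfPeriod
k = √λ R` fixes `k`, hence the solution. Above `lamStar R` no arc can fill the interval, so all arcs
are flat, of the same length; only finitely many fit, and the solution is their sum. Conversely,
flat arcs extended by zero are `C¹` with integrable second derivative, so disjoint ones add up to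
solutions. Scaling by `ω` identifies them with the bumps built from the critical solution. -/

namespace SingularEigenvalue

/-! ### The half-period as a function of the parameter `k` -/

/-- With `U = M cos φ`, the square of the angular speed `φ'` along a solution whose maximum `M`
is encoded in `k`, as a function of `c = cos φ`. -/
noncomputable def speedSq (k c : ℝ) : ℝ := 1 - k / ((1 + √c) * (1 + c))

/-- Half the length of the positivity interval of the normalised solution with parameter `k`. -/
noncomputable def halfPeriod (k : ℝ) : ℝ :=
  ∫ φ in (0 : ℝ)..(Real.pi / 2), 1 / √(speedSq k (Real.cos φ))

theorem speedSq_pos_of_pos {k c : ℝ} (hk : k ≤ 1) (hc : 0 < c) : 0 < speedSq k c := by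
  have h1 : 0 < √c := Real.sqrt_pos.2 hc
  have h2 : 1 < (1 + √c) * (1 + c) := by nlinarith
  rw [speedSq, sub_pos, div_lt_one (by linarith)]
  linarith

theorem speedSq_pos_of_lt_one {k c : ℝ} (hk : k < 1) (hc : 0 ≤ c) : 0 < speedSq k c := by
  have h1 : 0 ≤ √c := Real.sqrt_nonneg _
  have h2 : 1 ≤ (1 + √c) * (1 + c) := by nlinarith
  rw [speedSq, sub_pos, div_lt_one (by linarith)]
  linarith

theorem speedSq_zero_right (k : ℝ) : speedSq k 0 = 1 - k := by simp [speedSq]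

theorem one_sub_sq_mul_speedSq (k : ℝ) {c : ℝ} (hc : 0 ≤ c) :
    (1 - c ^ 2) * speedSq k c = 1 - c ^ 2 - k * (1 - √c) := by
  obtain ⟨s, hs, rfl⟩ : ∃ s, 0 ≤ s ∧ c = s ^ 2 := ⟨√c, Real.sqrt_nonneg _, (Real.sq_sqrt hc).symm⟩
  rw [speedSq, Real.sqrt_sq hs]
  have h1 : 1 + s ≠ 0 := by positivity
  have h2 : 1 + s ^ 2 ≠ 0 := by positivity
  field_simp
  ring

theorem speedSq_anti {k l c : ℝ} (hkl : k ≤ l) (hc : 0 ≤ c) : speedSq l c ≤ speedSq k c := by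
  unfold speedSq
  gcongr

theorem speedSq_strictAnti {k l c : ℝ} (hkl : k < l) (hc : 0 ≤ c) :
    speedSq l c < speedSq k c := by
  unfold speedSq
  gcongr

theorem cos_pos_of_mem_Ioo {φ : ℝ} (h : φ ∈ Ioo 0 (Real.pi / 2)) : 0 < Real.cos φ :=
  Real.cos_pos_of_mem_Ioo ⟨by linarith [h.1, Real.pi_pos], h.2⟩

theorem sin_pos_of_mem_Ioo {φ : ℝ} (h : φ ∈ Ioo 0 (Real.pi / 2)) : 0 < Real.sin φ :=
  Real.sin_pos_of_pos_of_lt_pi h.1 (by linarith [h.2, Real.pi_pos])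

/-- For `k = 1` the angle equation integrates in closed form, since `(1 - c²) speedSq 1 c = √c -
c²`. This primitive is the inverse of `cos φ = cos^(4/3)(3t/4)`. -/
theorem hasDerivAt_arccos_cos_rpow {φ : ℝ} (h : φ ∈ Ioo 0 (Real.pi / 2)) :
    HasDerivAt (fun φ => 4 / 3 * Real.arccos (Real.cos φ ^ (3 / 4 : ℝ)))
      (1 / √(speedSq 1 (Real.cos φ))) φ := by
  have hc := cos_pos_of_mem_Ioo h
  have hs := sin_pos_of_mem_Ioo h
  have hc1 : Real.cos φ < 1 := by nlinarith [Real.sin_sq_add_cos_sq φ]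
  have hp : Real.cos φ ^ (3 / 4 : ℝ) < 1 := Real.rpow_lt_one hc.le hc1 (by norm_num)
  have hp0 : 0 < Real.cos φ ^ (3 / 4 : ℝ) := Real.rpow_pos_of_pos hc _
  have h1 : HasDerivAt (fun φ => Real.cos φ ^ (3 / 4 : ℝ))
      (-Real.sin φ * (3 / 4 : ℝ) * Real.cos φ ^ ((3 / 4 : ℝ) - 1)) φ :=
    (Real.hasDerivAt_cos φ).rpow_const (Or.inl hc.ne')
  have h2 := ((Real.hasDerivAt_arccos (by linarith) hp.ne).comp φ h1).const_mul (4 / 3)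
  refine h2.congr_deriv ?_
  have e := one_sub_sq_mul_speedSq 1 hc.le
  have e2 : 0 < speedSq 1 (Real.cos φ) := speedSq_pos_of_pos le_rfl hc
  -- With `w` the fourth root of the cosine, all the fractional powers become integer powers, and
  -- the identity to check is `w² - w⁸ = w²(1 - w⁶)`.
  obtain ⟨w, hw, hcw⟩ : ∃ w, 0 < w ∧ Real.cos φ = w ^ 4 :=
    ⟨Real.cos φ ^ (1 / 4 : ℝ), Real.rpow_pos_of_pos hc _, by
      rw [← Real.rpow_natCast, ← Real.rpow_mul hc.le]; norm_num⟩
  have hw34 : Real.cos φ ^ (3 / 4 : ℝ) = w ^ 3 := by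
    rw [hcw, ← Real.rpow_natCast, ← Real.rpow_mul hw.le, ← Real.rpow_natCast]; norm_num
  have hw14 : Real.cos φ ^ ((3 / 4 : ℝ) - 1) = w⁻¹ := by
    rw [hcw, ← Real.rpow_natCast, ← Real.rpow_mul hw.le, ← Real.rpow_neg_one]; norm_num
  have hsq : √(Real.cos φ) = w ^ 2 := by
    rw [hcw, show w ^ 4 = (w ^ 2) ^ 2 by ring, Real.sqrt_sq (by positivity)]
  have hw1 : 0 < 1 - (w ^ 3) ^ 2 := by
    rw [← hw34]; nlinarith
  rw [hw34, hw14]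
  have e3 : √(speedSq 1 (Real.cos φ)) * Real.sin φ = w * √(1 - (w ^ 3) ^ 2) := by
    have : (√(speedSq 1 (Real.cos φ)) * Real.sin φ) ^ 2 = (w * √(1 - (w ^ 3) ^ 2)) ^ 2 := by
      rw [mul_pow, mul_pow, Real.sq_sqrt e2.le, Real.sq_sqrt hw1.le, Real.sin_sq, mul_comm, e,
        hsq, hcw]
      ring
    exact (pow_left_inj₀ (by positivity) (by positivity) two_ne_zero).1 this
  have e4 : 0 < √(speedSq 1 (Real.cos φ)) := Real.sqrt_pos.2 e2
  have e5 : 0 < √(1 - (w ^ 3) ^ 2) := Real.sqrt_pos.2 hw1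
  generalize √(1 - (w ^ 3) ^ 2) = A at e3 e5 ⊢
  generalize √(speedSq 1 (Real.cos φ)) = B at e3 e4 ⊢
  field_simp
  linarith

theorem continuous_arccos_cos_rpow :
    Continuous (fun φ => 4 / 3 * Real.arccos (Real.cos φ ^ (3 / 4 : ℝ))) :=
  continuous_const.mul (Real.continuous_arccos.comp
    (Real.continuous_cos.rpow_const (fun _ => Or.inr (by norm_num))))

theorem intervalIntegrable_halfPeriod_one :
    IntervalIntegrable (fun φ => 1 / √(speedSq 1 (Real.cos φ))) volume 0 (Real.pi / 2) := by
  have hpi : (0 : ℝ) ≤ Real.pi / 2 := by positivity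
  refine intervalIntegral.intervalIntegrable_deriv_of_nonneg
    continuous_arccos_cos_rpow.continuousOn ?_ ?_
  · rw [min_eq_left hpi, max_eq_right hpi]
    exact fun φ h => hasDerivAt_arccos_cos_rpow h
  · intros; positivity

theorem halfPeriod_one : halfPeriod 1 = 2 * Real.pi / 3 := by
  rw [halfPeriod, intervalIntegral.integral_eq_sub_of_hasDerivAt_of_le (by positivity)
    continuous_arccos_cos_rpow.continuousOn (fun φ h => hasDerivAt_arccos_cos_rpow h)
    intervalIntegrable_halfPeriod_one]
  simp
  ring

theorem aestronglyMeasurable_halfPeriod (k : ℝ) (μ : Measure ℝ) :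
    AEStronglyMeasurable (fun φ => 1 / √(speedSq k (Real.cos φ))) μ := by
  refine Measurable.aestronglyMeasurable ?_
  unfold speedSq
  fun_prop

/-- Serves to discard the endpoint `π/2`. There the bound by the integrand for `k = 1` is false when
`k < 1`, because `1 / √0` has the default value `0`. -/
theorem ae_uIoc_mem_Ioo {a b : ℝ} (hab : a ≤ b) {p : ℝ → Prop} (h : ∀ x ∈ Ioo a b, p x) :
    ∀ᵐ x ∂(volume : Measure ℝ), x ∈ uIoc a b → p x := by
  have : ∀ᵐ x ∂(volume : Measure ℝ), x ≠ b := by simp [ae_iff]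
  filter_upwards [this] with x hx hx'
  rw [uIoc_of_le hab] at hx'
  exact h x ⟨hx'.1, lt_of_le_of_ne hx'.2 hx⟩

theorem norm_halfPeriod_integrand_le {k φ : ℝ} (hk : k ≤ 1) (h : φ ∈ Ioo 0 (Real.pi / 2)) :
    ‖1 / √(speedSq k (Real.cos φ))‖ ≤ 1 / √(speedSq 1 (Real.cos φ)) := by
  have hc := cos_pos_of_mem_Ioo h
  rw [Real.norm_of_nonneg (by positivity)]
  have := Real.sqrt_pos.2 (speedSq_pos_of_pos le_rfl hc)
  gcongr
  exact speedSq_anti hk hc.le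

theorem intervalIntegrable_halfPeriod {k : ℝ} (hk : k ≤ 1) :
    IntervalIntegrable (fun φ => 1 / √(speedSq k (Real.cos φ))) volume 0 (Real.pi / 2) := by
  refine intervalIntegrable_halfPeriod_one.mono_fun' (aestronglyMeasurable_halfPeriod k _) ?_
  rw [Filter.EventuallyLE, ae_restrict_iff' measurableSet_uIoc]
  exact ae_uIoc_mem_Ioo (by positivity) (fun φ h => norm_halfPeriod_integrand_le hk h)

theorem halfPeriod_zero : halfPeriod 0 = Real.pi / 2 := by
  simp [halfPeriod, speedSq]

theorem strictMonoOn_halfPeriod : StrictMonoOn halfPeriod (Iic 1) := by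
  intro k hk l hl hkl
  rw [← sub_pos, halfPeriod, halfPeriod,
    ← intervalIntegral.integral_sub (intervalIntegrable_halfPeriod hl)
      (intervalIntegrable_halfPeriod hk)]
  refine intervalIntegral.intervalIntegral_pos_of_pos_on
    ((intervalIntegrable_halfPeriod hl).sub (intervalIntegrable_halfPeriod hk)) ?_ (by positivity)
  intro φ h
  have hc := cos_pos_of_mem_Ioo h
  have h1 := Real.sqrt_pos.2 (speedSq_pos_of_pos hl hc)
  rw [sub_pos]
  refine one_div_lt_one_div_of_lt h1 ?_
  exact Real.sqrt_lt_sqrt (speedSq_pos_of_pos hl hc).le (speedSq_strictAnti hkl hc.le)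

/-- Dominated convergence: the integrands increase with `k`, so the integrable one for `k = 1`
bounds them all. -/
theorem continuousOn_halfPeriod : ContinuousOn halfPeriod (Iic 1) := by
  intro k hk
  refine intervalIntegral.continuousWithinAt_of_dominated_interval
    (bound := fun φ => 1 / √(speedSq 1 (Real.cos φ)))
    (.of_forall fun k => aestronglyMeasurable_halfPeriod k _) ?_
    intervalIntegrable_halfPeriod_one ?_
  · filter_upwards [self_mem_nhdsWithin] with l hl
    exact ae_uIoc_mem_Ioo (by positivity) (fun φ h => norm_halfPeriod_integrand_le hl h)
  · refine ae_uIoc_mem_Ioo (by positivity) (fun φ h => ContinuousAt.continuousWithinAt ?_)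
    have h1 := Real.sqrt_pos.2 (speedSq_pos_of_pos hk (cos_pos_of_mem_Ioo h))
    refine ContinuousAt.div continuousAt_const ?_ h1.ne'
    unfold speedSq
    fun_prop

theorem exists_halfPeriod_eq {T : ℝ} (h1 : Real.pi / 2 < T) (h2 : T < 2 * Real.pi / 3) :
    ∃ k ∈ Ioo (0 : ℝ) 1, halfPeriod k = T := by
  have := intermediate_value_Ioo zero_le_one (continuousOn_halfPeriod.mono Icc_subset_Iic_self)
  rw [halfPeriod_zero, halfPeriod_one] at this
  exact this ⟨h1, h2⟩

theorem halfPeriod_gt {k : ℝ} (h0 : 0 < k) (h1 : k ≤ 1) : Real.pi / 2 < halfPeriod k := by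
  rw [← halfPeriod_zero]
  exact strictMonoOn_halfPeriod (by simp) h1 h0

/-! ### The function `γ` and the critical value in terms of the half-period -/

theorem rF_pos : 0 < rF := by unfold rF; positivity

theorem rF_mul_sqrt : rF * √rF = 4 := by
  have h : (rF * √rF) ^ 2 = 4 ^ 2 := by
    rw [mul_pow, Real.sq_sqrt rF_pos.le, rF, mul_pow, ← Real.rpow_mul_natCast (by norm_num)]
    have : ((2 : ℝ) ^ (1 / 3 : ℝ)) ^ 3 = 2 := by
      rw [← Real.rpow_mul_natCast (by norm_num)]; norm_num
    have h3 : (2 : ℝ) ^ (1 / 3 * ((2 : ℕ) : ℝ)) = ((2 : ℝ) ^ (1 / 3 : ℝ)) ^ 2 := by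
      rw [← Real.rpow_mul_natCast (by norm_num)]
    rw [h3]
    nlinarith
  have := rF_pos
  exact (pow_left_inj₀ (by positivity) (by positivity) two_ne_zero).1 h

theorem four_le_mul_sqrt {μ : ℝ} (h : rF ≤ μ) : 4 ≤ μ * √μ := by
  rw [← rF_mul_sqrt]
  have := rF_pos
  gcongr
  linarith

/-- The factor `1 - c²` is `sin² φ` for `c = cos φ`, so its root cancels the Jacobian of `r = μ cos
φ` and with it the singularity at `r = μ`. -/
theorem F_sub_F_mul {μ c : ℝ} (hμ : 0 < μ) (hc : 0 ≤ c) :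
    F μ - F (μ * c) = μ ^ 2 / 2 * ((1 - c ^ 2) * speedSq (4 / (μ * √μ)) c) := by
  rw [one_sub_sq_mul_speedSq _ hc, F, F, Real.sqrt_mul hμ.le]
  have h : 0 < √μ := Real.sqrt_pos.2 hμ
  obtain ⟨s, hs⟩ : ∃ s, s = √μ := ⟨_, rfl⟩
  have hm : μ = s ^ 2 := by rw [hs, Real.sq_sqrt hμ.le]
  rw [← hs] at h ⊢
  subst hm
  field_simp
  ring

theorem image_mul_cos {μ : ℝ} (hμ : 0 < μ) :
    (fun φ => μ * Real.cos φ) '' Ioo 0 (Real.pi / 2) = Ioo 0 μ := by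
  ext r
  constructor
  · rintro ⟨φ, h, rfl⟩
    have hc := cos_pos_of_mem_Ioo h
    have hs := sin_pos_of_mem_Ioo h
    have hc1 : Real.cos φ < 1 := by nlinarith [Real.sin_sq_add_cos_sq φ]
    exact ⟨by positivity, by nlinarith⟩
  · rintro ⟨h0, h1⟩
    have hq : r / μ < 1 := by rwa [div_lt_one hμ]
    have hq0 : 0 < r / μ := by positivity
    refine ⟨Real.arccos (r / μ), ⟨Real.arccos_pos.2 hq, Real.arccos_lt_pi_div_two.2 hq0⟩, ?_⟩
    simp only
    rw [Real.cos_arccos (by linarith) hq.le]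
    field_simp

theorem abs_deriv_smul_integrand {μ φ : ℝ} (hμ : rF ≤ μ) (h : φ ∈ Ioo 0 (Real.pi / 2)) :
    |-(μ * Real.sin φ)| • (1 / √(F μ - F (μ * Real.cos φ))) =
      √2 * (1 / √(speedSq (4 / (μ * √μ)) (Real.cos φ))) := by
  have hμ0 : 0 < μ := rF_pos.trans_le hμ
  have hc := cos_pos_of_mem_Ioo h
  have hs := sin_pos_of_mem_Ioo h
  have h4 := four_le_mul_sqrt hμ
  have h5 : 4 / (μ * √μ) ≤ 1 := by rw [div_le_one (by linarith)]; exact h4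
  have hp := speedSq_pos_of_pos h5 hc
  rw [F_sub_F_mul hμ0 hc.le, ← Real.sin_sq, Real.sqrt_mul (by positivity),
    Real.sqrt_mul (by positivity), Real.sqrt_sq hs.le, Real.sqrt_div (by positivity),
    Real.sqrt_sq hμ0.le, abs_neg, abs_of_pos (by positivity), smul_eq_mul]
  have := Real.sqrt_pos.2 hp
  field_simp

theorem intervalIntegrable_gamma {μ : ℝ} (hμ : rF ≤ μ) :
    IntervalIntegrable (fun r => 1 / √(F μ - F r)) volume 0 μ := by
  have hμ0 : 0 < μ := rF_pos.trans_le hμ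
  have h4 := four_le_mul_sqrt hμ
  have h5 : 4 / (μ * √μ) ≤ 1 := by rw [div_le_one (by linarith)]; exact h4
  rw [intervalIntegrable_iff_integrableOn_Ioo_of_le hμ0.le, ← image_mul_cos hμ0,
    integrableOn_image_iff_integrableOn_abs_deriv_smul measurableSet_Ioo
      (f' := fun φ => -(μ * Real.sin φ)) ?_ ?_]
  · rw [integrableOn_congr_fun (fun φ h => abs_deriv_smul_integrand hμ h) measurableSet_Ioo,
      ← intervalIntegrable_iff_integrableOn_Ioo_of_le (by positivity)]
    exact (intervalIntegrable_halfPeriod h5).const_mul _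
  · intro φ _
    have := (Real.hasDerivAt_cos φ).const_mul μ
    rw [mul_neg] at this
    exact this.hasDerivWithinAt
  · intro x hx y hy hxy
    have : Real.cos x = Real.cos y := mul_left_cancel₀ hμ0.ne' hxy
    exact Real.injOn_cos ⟨hx.1.le, by linarith [hx.2, Real.pi_pos]⟩
      ⟨hy.1.le, by linarith [hy.2, Real.pi_pos]⟩ this

theorem gamma_eq_halfPeriod {μ : ℝ} (hμ : rF ≤ μ) : gamma μ = halfPeriod (4 / (μ * √μ)) := by
  have hμ0 : 0 < μ := rF_pos.trans_le hμ
  rw [gamma, intervalIntegral.integral_of_le hμ0.le, integral_Ioc_eq_integral_Ioo,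
    ← image_mul_cos hμ0, integral_image_eq_integral_abs_deriv_smul measurableSet_Ioo
      (f' := fun φ => -(μ * Real.sin φ)) ?_ ?_]
  · rw [setIntegral_congr_fun measurableSet_Ioo (fun φ h => abs_deriv_smul_integrand hμ h),
      integral_const_mul, halfPeriod, intervalIntegral.integral_of_le (by positivity),
      integral_Ioc_eq_integral_Ioo]
    field_simp
  · intro φ _
    have := (Real.hasDerivAt_cos φ).const_mul μ
    rw [mul_neg] at this
    exact this.hasDerivWithinAt
  · intro x hx y hy hxy
    have : Real.cos x = Real.cos y := mul_left_cancel₀ hμ0.ne' hxy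
    exact Real.injOn_cos ⟨hx.1.le, by linarith [hx.2, Real.pi_pos]⟩
      ⟨hy.1.le, by linarith [hy.2, Real.pi_pos]⟩ this

theorem lamStar_eq {R : ℝ} (hR : 0 < R) : lamStar R = (2 * Real.pi / 3 / R) ^ 2 := by
  have h := gamma_eq_halfPeriod le_rfl
  rw [rF_mul_sqrt, div_self (by norm_num), halfPeriod_one, gamma] at h
  have h2 : ∫ r in (0 : ℝ)..rF, 1 / √(F rF - F r) = √2 * (2 * Real.pi / 3) := by
    rw [← h]; field_simp
  rw [lamStar, h2, mul_pow, Real.sq_sqrt (by norm_num)]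
  field_simp

/-! ### Normalised profiles with `k < 1` -/

/-- `s`, with derivative `s₁`, is the solution of `s'' = k / (4√s) - s`, `s(0) = 1`, `s'(0) = 0`,
which is positive exactly up to the times `±T`. -/
structure IsProfile (k T : ℝ) (s s₁ : ℝ → ℝ) : Prop where
  period_pos : 0 < T
  continuous : Continuous s
  apply_zero : s 0 = 1
  deriv_zero : s₁ 0 = 0
  apply_right : s T = 0
  apply_left : s (-T) = 0
  deriv_right : s₁ T = -√(1 - k)
  deriv_left : s₁ (-T) = √(1 - k)
  pos : ∀ t ∈ Ioo (-T) T, 0 < s t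
  le_one : ∀ t ∈ Ioo (-T) T, s t ≤ 1
  hasDerivAt : ∀ t ∈ Icc (-T) T, HasDerivAt s (s₁ t) t
  hasDerivAt_deriv : ∀ t ∈ Ioo (-T) T, HasDerivAt s₁ (k / (4 * √(s t)) - s t) t

/-- The angle as a function of time is the inverse of this function. -/
noncomputable def angleTime (k φ : ℝ) : ℝ :=
  ∫ ψ in (0 : ℝ)..φ, 1 / √(speedSq k |Real.cos ψ|)

/-- The absolute value extends the speed to all angles, and `k < 1` keeps it positive where the
cosine vanishes, its square there being `1 - k`. The time can therefore be inverted on the whole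
line. -/
theorem continuous_angleTime_integrand {k : ℝ} (hk : k < 1) :
    Continuous fun ψ => 1 / √(speedSq k |Real.cos ψ|) := by
  have h0 : ∀ ψ, 0 < speedSq k |Real.cos ψ| := fun ψ => speedSq_pos_of_lt_one hk (abs_nonneg _)
  have h1 : Continuous fun ψ => speedSq k |Real.cos ψ| := by
    unfold speedSq
    refine continuous_const.sub (continuous_const.div (by fun_prop) fun ψ => ?_)
    positivity
  exact continuous_const.div h1.sqrt fun ψ => (Real.sqrt_pos.2 (h0 ψ)).ne'

theorem hasDerivAt_angleTime {k : ℝ} (hk : k < 1) (φ : ℝ) :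
    HasDerivAt (angleTime k) (1 / √(speedSq k |Real.cos φ|)) φ := by
  have h := continuous_angleTime_integrand hk
  exact intervalIntegral.integral_hasDerivAt_right (h.intervalIntegrable _ _)
    (h.stronglyMeasurableAtFilter _ _) h.continuousAt

theorem continuous_angleTime {k : ℝ} (hk : k < 1) : Continuous (angleTime k) :=
  continuous_iff_continuousAt.2 fun φ => (hasDerivAt_angleTime hk φ).continuousAt

theorem strictMono_angleTime {k : ℝ} (hk : k < 1) : StrictMono (angleTime k) := by
  refine strictMono_of_hasDerivAt_pos (hasDerivAt_angleTime hk) fun φ => ?_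
  have := speedSq_pos_of_lt_one hk (abs_nonneg (Real.cos φ))
  positivity

theorem angleTime_neg (k φ : ℝ) : angleTime k (-φ) = -angleTime k φ := by
  unfold angleTime
  rw [← intervalIntegral.integral_symm]
  have := intervalIntegral.integral_comp_neg (a := φ) (b := 0)
    (fun ψ => 1 / √(speedSq k |Real.cos ψ|))
  simp only [Real.cos_neg, neg_zero] at this
  exact this.symm

theorem angleTime_zero (k : ℝ) : angleTime k 0 = 0 := by simp [angleTime]

theorem angleTime_pi_div_two (k : ℝ) : angleTime k (Real.pi / 2) = halfPeriod k := by
  unfold angleTime halfPeriod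
  refine intervalIntegral.integral_congr fun φ h => ?_
  rw [uIcc_of_le (by positivity)] at h
  have : 0 ≤ Real.cos φ :=
    Real.cos_nonneg_of_mem_Icc ⟨by linarith [h.1, Real.pi_pos], h.2⟩
  simp only [abs_of_nonneg this]

/-- For `k ≥ 0` the angular speed is at most `1`. The bound makes the time unbounded in both
directions, whence surjectivity. -/
theorem le_angleTime {k φ : ℝ} (h0 : 0 ≤ k) (hk : k < 1) (hφ : 0 ≤ φ) : φ ≤ angleTime k φ := by
  have h : ∫ _ in (0 : ℝ)..φ, (1 : ℝ) ≤ angleTime k φ := by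
    refine intervalIntegral.integral_mono_on hφ intervalIntegrable_const
      ((continuous_angleTime_integrand hk).intervalIntegrable _ _) fun ψ _ => ?_
    have h1 := speedSq_pos_of_lt_one hk (abs_nonneg (Real.cos ψ))
    have h2 : speedSq k |Real.cos ψ| ≤ 1 := by
      simpa [speedSq] using speedSq_anti h0 (abs_nonneg (Real.cos ψ))
    rw [le_div_iff₀ (Real.sqrt_pos.2 h1), one_mul]
    exact Real.sqrt_le_one.2 h2
  simpa using h

theorem surjective_angleTime {k : ℝ} (h0 : 0 ≤ k) (hk : k < 1) :
    Function.Surjective (angleTime k) := by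
  refine (continuous_angleTime hk).surjective ?_ ?_
  · refine Filter.tendsto_atTop_mono' _ ?_ Filter.tendsto_id
    filter_upwards [Filter.eventually_ge_atTop 0] with φ hφ using le_angleTime h0 hk hφ
  · refine Filter.tendsto_atBot_mono' _ ?_ Filter.tendsto_id
    filter_upwards [Filter.eventually_le_atBot 0] with φ hφ
    have := le_angleTime h0 hk (neg_nonneg.2 hφ)
    rw [angleTime_neg] at this
    simp only [id]
    linarith

theorem exists_angle {k : ℝ} (h0 : 0 ≤ k) (hk : k < 1) :
    ∃ Φ : ℝ → ℝ, (∀ t, HasDerivAt Φ (√(speedSq k |Real.cos (Φ t)|)) t) ∧ StrictMono Φ ∧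
      Φ 0 = 0 ∧ Φ (halfPeriod k) = Real.pi / 2 ∧ Φ (-halfPeriod k) = -(Real.pi / 2) := by
  have hm := strictMono_angleTime hk
  let e : ℝ ≃o ℝ := hm.orderIsoOfSurjective _ (surjective_angleTime h0 hk)
  have he : ∀ φ, e φ = angleTime k φ := fun φ => rfl
  refine ⟨e.symm, fun t => ?_, e.symm.strictMono, ?_, ?_, ?_⟩
  · have h1 := speedSq_pos_of_lt_one hk (abs_nonneg (Real.cos (e.symm t)))
    have h2 : HasDerivAt e.symm (1 / √(speedSq k |Real.cos (e.symm t)|))⁻¹ t :=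
      HasDerivAt.of_local_left_inverse e.symm.continuous.continuousAt
        (hasDerivAt_angleTime hk _) (by positivity)
        (.of_forall fun y => e.apply_symm_apply y)
    simpa using h2
  · rw [e.symm_apply_eq, he, angleTime_zero]
  · rw [e.symm_apply_eq, he, angleTime_pi_div_two]
  · rw [e.symm_apply_eq, he, angleTime_neg, angleTime_pi_div_two]

/-- Differentiating `one_sub_sq_mul_speedSq` gives the derivative only up to the factor `1 - c²`.
This suffices: in the second derivative of `cos Φ` it appears multiplied by `sin² Φ = 1 - c²`, so
the maximum `c = 1` needs no separate treatment. -/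
theorem exists_hasDerivAt_speedSq (k : ℝ) {c : ℝ} (hc : 0 < c) :
    ∃ g', HasDerivAt (speedSq k) g' c ∧
      (1 - c ^ 2) * g' = 2 * c * speedSq k c - 2 * c + k / (2 * √c) := by
  have hd : DifferentiableAt ℝ (speedSq k) c := by
    have h1 : DifferentiableAt ℝ (fun c : ℝ => √c) c :=
      (Real.hasDerivAt_sqrt hc.ne').differentiableAt
    unfold speedSq
    have h2 : (1 + √c) * (1 + c) ≠ 0 := by positivity
    fun_prop (disch := assumption)
  obtain ⟨g', hg⟩ : ∃ g', HasDerivAt (speedSq k) g' c := ⟨_, hd.hasDerivAt⟩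
  refine ⟨g', hg, ?_⟩
  have e1 : HasDerivAt (fun c => (1 - c ^ 2) * speedSq k c)
      (-(2 * c) * speedSq k c + (1 - c ^ 2) * g') c := by
    have : HasDerivAt (fun c : ℝ => 1 - c ^ 2) (-(2 * c)) c := by
      simpa using (hasDerivAt_pow 2 c).const_sub 1
    exact this.mul hg
  have e2 : HasDerivAt (fun c => 1 - c ^ 2 - k * (1 - √c))
      (-(2 * c) - k * -(1 / (2 * √c))) c := by
    have h1 : HasDerivAt (fun c : ℝ => 1 - c ^ 2) (-(2 * c)) c := by
      simpa using (hasDerivAt_pow 2 c).const_sub 1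
    exact h1.sub (((Real.hasDerivAt_sqrt hc.ne').const_sub 1).const_mul k)
  have e3 : (fun c => (1 - c ^ 2) * speedSq k c) =ᶠ[nhds c] fun c => 1 - c ^ 2 - k * (1 - √c) := by
    filter_upwards [lt_mem_nhds hc] with x hx using one_sub_sq_mul_speedSq k (le_of_lt hx)
  have := e1.unique (e2.congr_of_eventuallyEq e3)
  have h4 : k * -(1 / (2 * √c)) = -(k / (2 * √c)) := by ring
  linarith

theorem exists_isProfile_of_lt_one {k : ℝ} (h0 : 0 ≤ k) (hk : k < 1) (hT : 0 < halfPeriod k) :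
    ∃ s s₁, IsProfile k (halfPeriod k) s s₁ := by
  obtain ⟨Φ, hΦ, hmono, hΦ0, hΦr, hΦl⟩ := exists_angle h0 hk
  have hcos : ∀ t ∈ Ioo (-halfPeriod k) (halfPeriod k), 0 < Real.cos (Φ t) := fun t ht =>
    Real.cos_pos_of_mem_Ioo ⟨by rw [← hΦl]; exact hmono ht.1, by rw [← hΦr]; exact hmono ht.2⟩
  refine ⟨fun t => Real.cos (Φ t), fun t => -Real.sin (Φ t) * √(speedSq k |Real.cos (Φ t)|),
    hT, ?_, ?_, ?_, ?_, ?_, ?_, ?_, hcos, fun t _ => Real.cos_le_one _,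
    fun t _ => (hΦ t).cos, ?_⟩
  · exact Real.continuous_cos.comp (continuous_iff_continuousAt.2 fun t => (hΦ t).continuousAt)
  · simp [hΦ0]
  · simp [hΦ0]
  · simp [hΦr]
  · simp [hΦl]
  · simp [hΦr, speedSq_zero_right]
  · simp [hΦl, speedSq_zero_right]
  · intro t ht
    have hc := hcos t ht
    have hg0 := speedSq_pos_of_lt_one hk hc.le
    obtain ⟨g', hg, hg'⟩ := exists_hasDerivAt_speedSq k hc
    have e : (fun t => -Real.sin (Φ t) * √(speedSq k |Real.cos (Φ t)|)) =ᶠ[nhds t]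
        fun t => -Real.sin (Φ t) * √(speedSq k (Real.cos (Φ t))) := by
      filter_upwards [Ioo_mem_nhds ht.1 ht.2] with x hx
      rw [abs_of_pos (hcos x hx)]
    refine HasDerivAt.congr_of_eventuallyEq ?_ e
    have hΦt := hΦ t
    rw [abs_of_pos hc] at hΦt
    have h1 : HasDerivAt (fun t => √(speedSq k (Real.cos (Φ t))))
        (g' * (-Real.sin (Φ t) * √(speedSq k (Real.cos (Φ t)))) /
          (2 * √(speedSq k (Real.cos (Φ t))))) t := by
      have h := HasDerivAt.comp t hg hΦt.cos
      exact h.sqrt hg0.ne'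
    refine (hΦt.sin.neg.mul h1).congr_deriv ?_
    simp only [Pi.neg_apply]
    have h2 := Real.sqrt_pos.2 hg0
    have h3 := Real.sq_sqrt hg0.le
    have h4 := Real.sin_sq (Φ t)
    generalize √(speedSq k (Real.cos (Φ t))) = q at *
    have h5 : k / (4 * √(Real.cos (Φ t))) = k / (2 * √(Real.cos (Φ t))) / 2 := by ring
    rw [h5]
    have h6 : g' * (-Real.sin (Φ t) * q) / (2 * q) = -(g' * Real.sin (Φ t)) / 2 := by
      field_simp
    rw [h6]
    have h7 : -(Real.cos (Φ t) * q) * q + -Real.sin (Φ t) * (-(g' * Real.sin (Φ t)) / 2) =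
      -Real.cos (Φ t) * q ^ 2 + g' * Real.sin (Φ t) ^ 2 / 2 := by ring
    rw [h7, h3, h4]
    linarith

/-! ### The flat profile, `k = 1` -/

/-- The truncation of the line to the positivity interval of the flat profile. -/
noncomputable def flatClamp (t : ℝ) : ℝ := max (-(2 * Real.pi / 3)) (min (2 * Real.pi / 3) t)

/-- The flat profile, extended by zero. -/
noncomputable def flatProfile (t : ℝ) : ℝ := Real.cos (3 / 4 * flatClamp t) ^ (4 / 3 : ℝ)

/-- The derivative of the flat profile. -/
noncomputable def flatProfileDeriv (t : ℝ) : ℝ :=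
  -(Real.cos (3 / 4 * flatClamp t) ^ (1 / 3 : ℝ) * Real.sin (3 / 4 * flatClamp t))

theorem continuous_flatClamp : Continuous flatClamp := by unfold flatClamp; fun_prop

theorem flatClamp_of_mem {t : ℝ} (h : t ∈ Icc (-(2 * Real.pi / 3)) (2 * Real.pi / 3)) :
    flatClamp t = t := by
  rw [flatClamp, min_eq_right h.2, max_eq_right h.1]

theorem flatClamp_of_ge {t : ℝ} (h : 2 * Real.pi / 3 ≤ t) : flatClamp t = 2 * Real.pi / 3 := by
  rw [flatClamp, min_eq_left h, max_eq_right (by linarith [Real.pi_pos])]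

theorem flatClamp_of_le {t : ℝ} (h : t ≤ -(2 * Real.pi / 3)) :
    flatClamp t = -(2 * Real.pi / 3) := by
  rw [flatClamp, min_eq_right (by linarith [Real.pi_pos]), max_eq_left h]

theorem cos_three_fourths : Real.cos (3 / 4 * (2 * Real.pi / 3)) = 0 := by
  rw [show 3 / 4 * (2 * Real.pi / 3) = Real.pi / 2 by ring, Real.cos_pi_div_two]

theorem cos_flatClamp_eq_zero {t : ℝ} (h : t ∉ Ioo (-(2 * Real.pi / 3)) (2 * Real.pi / 3)) :
    Real.cos (3 / 4 * flatClamp t) = 0 := by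
  rcases le_or_gt (2 * Real.pi / 3) t with h1 | h1
  · rw [flatClamp_of_ge h1, cos_three_fourths]
  · have h2 : t ≤ -(2 * Real.pi / 3) := by
      by_contra h3
      exact h ⟨not_le.1 h3, h1⟩
    rw [flatClamp_of_le h2, mul_neg, Real.cos_neg, cos_three_fourths]

theorem cos_pos_of_flat {t : ℝ} (h : t ∈ Ioo (-(2 * Real.pi / 3)) (2 * Real.pi / 3)) :
    0 < Real.cos (3 / 4 * t) :=
  Real.cos_pos_of_mem_Ioo ⟨by linarith [h.1], by linarith [h.2]⟩

theorem flatProfile_eq_zero {t : ℝ} (h : t ∉ Ioo (-(2 * Real.pi / 3)) (2 * Real.pi / 3)) :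
    flatProfile t = 0 := by
  rw [flatProfile, cos_flatClamp_eq_zero h, Real.zero_rpow (by norm_num)]

theorem flatProfileDeriv_eq_zero {t : ℝ} (h : t ∉ Ioo (-(2 * Real.pi / 3)) (2 * Real.pi / 3)) :
    flatProfileDeriv t = 0 := by
  rw [flatProfileDeriv, cos_flatClamp_eq_zero h, Real.zero_rpow (by norm_num), zero_mul, neg_zero]

theorem continuous_flatProfile : Continuous flatProfile :=
  (Real.continuous_cos.comp (continuous_const.mul continuous_flatClamp)).rpow_const
    fun _ => Or.inr (by norm_num)

theorem continuous_flatProfileDeriv : Continuous flatProfileDeriv :=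
  (((Real.continuous_cos.comp (continuous_const.mul continuous_flatClamp)).rpow_const
    fun _ => Or.inr (by norm_num)).mul
    (Real.continuous_sin.comp (continuous_const.mul continuous_flatClamp))).neg

theorem hasDerivAt_cos_three_fourths (t : ℝ) :
    HasDerivAt (fun t => Real.cos (3 / 4 * t)) (-Real.sin (3 / 4 * t) * (3 / 4)) t := by
  have h1 : HasDerivAt (fun t : ℝ => 3 / 4 * t) (3 / 4) t := by
    simpa using (hasDerivAt_id t).const_mul (3 / 4 : ℝ)
  exact h1.cos

theorem hasDerivAt_flatProfile (t : ℝ) : HasDerivAt flatProfile (flatProfileDeriv t) t := by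
  by_cases ht : t ∈ Ioo (-(2 * Real.pi / 3)) (2 * Real.pi / 3)
  · have hc := cos_pos_of_flat ht
    have e : flatProfile =ᶠ[nhds t] fun t => Real.cos (3 / 4 * t) ^ (4 / 3 : ℝ) := by
      filter_upwards [Ioo_mem_nhds ht.1 ht.2] with x hx
      rw [flatProfile, flatClamp_of_mem (Ioo_subset_Icc_self hx)]
    refine HasDerivAt.congr_of_eventuallyEq ?_ e
    refine ((hasDerivAt_cos_three_fourths t).rpow_const (Or.inl hc.ne')).congr_deriv ?_
    rw [flatProfileDeriv, flatClamp_of_mem (Ioo_subset_Icc_self ht)]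
    norm_num
    ring
  · rw [flatProfileDeriv_eq_zero ht]
    by_cases hn : t ∈ Icc (-(2 * Real.pi / 3)) (2 * Real.pi / 3)
    · have hc : Real.cos (3 / 4 * t) = 0 := by
        have := cos_flatClamp_eq_zero ht
        rwa [flatClamp_of_mem hn] at this
      -- At an edge the profile is dominated by this function, which vanishes there to first order
      -- since `4/3 > 1`. The domination avoids treating the two sides separately.
      have h1 : HasDerivAt (fun t => |Real.cos (3 / 4 * t)| ^ (4 / 3 : ℝ)) 0 t := by
        have h2 := (hasDerivAt_abs_rpow (Real.cos (3 / 4 * t)) (p := 4 / 3) (by norm_num)).comp t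
          (hasDerivAt_cos_three_fourths t)
        refine h2.congr_deriv ?_
        simp [hc]
      rw [hasDerivAt_iff_isLittleO] at h1 ⊢
      refine Asymptotics.IsBigO.trans_isLittleO (Asymptotics.IsBigO.of_bound 1 ?_) h1
      refine .of_forall fun x => ?_
      rw [flatProfile_eq_zero ht, hc]
      simp only [abs_zero, smul_zero, sub_zero, one_mul]
      rw [Real.zero_rpow (by norm_num), sub_zero]
      by_cases hx : x ∈ Ioo (-(2 * Real.pi / 3)) (2 * Real.pi / 3)
      · rw [flatProfile, flatClamp_of_mem (Ioo_subset_Icc_self hx), abs_of_pos (cos_pos_of_flat hx)]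
      · rw [flatProfile_eq_zero hx, norm_zero]
        positivity
    · have e : flatProfile =ᶠ[nhds t] fun _ => 0 := by
        filter_upwards [isClosed_Icc.isOpen_compl.mem_nhds hn] with x hx
        exact flatProfile_eq_zero fun h => hx (Ioo_subset_Icc_self h)
      exact (hasDerivAt_const t (0 : ℝ)).congr_of_eventuallyEq e

theorem hasDerivAt_flatProfileDeriv {t : ℝ}
    (ht : t ∈ Ioo (-(2 * Real.pi / 3)) (2 * Real.pi / 3)) :
    HasDerivAt flatProfileDeriv (1 / (4 * √(flatProfile t)) - flatProfile t) t := by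
  have hc := cos_pos_of_flat ht
  have e : flatProfileDeriv =ᶠ[nhds t]
      fun t => -(Real.cos (3 / 4 * t) ^ (1 / 3 : ℝ) * Real.sin (3 / 4 * t)) := by
    filter_upwards [Ioo_mem_nhds ht.1 ht.2] with x hx
    rw [flatProfileDeriv, flatClamp_of_mem (Ioo_subset_Icc_self hx)]
  refine HasDerivAt.congr_of_eventuallyEq ?_ e
  have h1 : HasDerivAt (fun t : ℝ => 3 / 4 * t) (3 / 4) t := by
    simpa using (hasDerivAt_id t).const_mul (3 / 4 : ℝ)
  refine (((hasDerivAt_cos_three_fourths t).rpow_const (Or.inl hc.ne')).mul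
    h1.sin).neg.congr_deriv ?_
  rw [flatProfile, flatClamp_of_mem (Ioo_subset_Icc_self ht)]
  obtain ⟨w, hw, hcw⟩ : ∃ w, 0 < w ∧ Real.cos (3 / 4 * t) = w ^ 3 :=
    ⟨Real.cos (3 / 4 * t) ^ (1 / 3 : ℝ), Real.rpow_pos_of_pos hc _, by
      rw [← Real.rpow_natCast, ← Real.rpow_mul hc.le]; norm_num⟩
  have p1 : Real.cos (3 / 4 * t) ^ (4 / 3 : ℝ) = w ^ 4 := by
    rw [hcw, ← Real.rpow_natCast, ← Real.rpow_mul hw.le, ← Real.rpow_natCast]; norm_num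
  have p2 : Real.cos (3 / 4 * t) ^ (1 / 3 : ℝ) = w := by
    rw [hcw, ← Real.rpow_natCast, ← Real.rpow_mul hw.le]; norm_num
  have p3 : Real.cos (3 / 4 * t) ^ ((1 / 3 : ℝ) - 1) = (w ^ 2)⁻¹ := by
    rw [hcw, ← Real.rpow_natCast, ← Real.rpow_mul hw.le, ← Real.rpow_natCast, ← Real.rpow_neg hw.le]
    norm_num
  have p4 : √(w ^ 4) = w ^ 2 := by
    rw [show w ^ 4 = (w ^ 2) ^ 2 by ring, Real.sqrt_sq (by positivity)]
  have p5 := Real.sin_sq (3 / 4 * t)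
  rw [p1, p2, p3, p4, hcw]
  rw [hcw] at p5
  generalize Real.sin (3 / 4 * t) = v at p5 ⊢
  field_simp
  linear_combination p5

theorem isProfile_flat : IsProfile 1 (halfPeriod 1) flatProfile flatProfileDeriv := by
  have hpi : (0 : ℝ) < 2 * Real.pi / 3 := by positivity
  rw [halfPeriod_one]
  refine ⟨hpi, continuous_flatProfile, ?_, ?_, flatProfile_eq_zero (by simp),
    flatProfile_eq_zero (by simp), ?_, ?_, ?_, ?_, fun t _ => hasDerivAt_flatProfile t,
    fun t ht => hasDerivAt_flatProfileDeriv ht⟩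
  · rw [flatProfile, flatClamp_of_mem ⟨by linarith, hpi.le⟩]; simp
  · rw [flatProfileDeriv, flatClamp_of_mem ⟨by linarith, hpi.le⟩]; simp
  · rw [flatProfileDeriv_eq_zero (by simp)]; simp
  · rw [flatProfileDeriv_eq_zero (by simp)]; simp
  · intro t ht
    rw [flatProfile, flatClamp_of_mem (Ioo_subset_Icc_self ht)]
    exact Real.rpow_pos_of_pos (cos_pos_of_flat ht) _
  · intro t ht
    rw [flatProfile, flatClamp_of_mem (Ioo_subset_Icc_self ht)]
    exact Real.rpow_le_one (cos_pos_of_flat ht).le (Real.cos_le_one _) (by norm_num)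

theorem exists_isProfile {k : ℝ} (h0 : 0 < k) (hk : k ≤ 1) :
    ∃ s s₁, IsProfile k (halfPeriod k) s s₁ := by
  rcases hk.lt_or_eq with h | rfl
  · exact exists_isProfile_of_lt_one h0.le h
      ((by positivity : 0 < Real.pi / 2).trans (halfPeriod_gt h0 hk))
  · exact ⟨_, _, isProfile_flat⟩

theorem flatProfile_le_one (t : ℝ) : flatProfile t ≤ 1 := by
  by_cases h : t ∈ Ioo (-(2 * Real.pi / 3)) (2 * Real.pi / 3)
  · exact isProfile_flat.le_one t (by rwa [halfPeriod_one])
  · rw [flatProfile_eq_zero h]; exact zero_le_one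

/-- The second derivative of the flat profile, wherever it exists. -/
noncomputable def flatProfileDeriv₂ (t : ℝ) : ℝ :=
  (Ioo (-(2 * Real.pi / 3)) (2 * Real.pi / 3)).indicator
    (fun t => 1 / (4 * √(flatProfile t)) - flatProfile t) t

theorem hasDerivAt_flatProfileDeriv_off {t : ℝ} (h1 : t ≠ -(2 * Real.pi / 3))
    (h2 : t ≠ 2 * Real.pi / 3) : HasDerivAt flatProfileDeriv (flatProfileDeriv₂ t) t := by
  by_cases ht : t ∈ Ioo (-(2 * Real.pi / 3)) (2 * Real.pi / 3)
  · rw [flatProfileDeriv₂, indicator_of_mem ht]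
    exact hasDerivAt_flatProfileDeriv ht
  · rw [flatProfileDeriv₂, indicator_of_notMem ht]
    have hn : t ∉ Icc (-(2 * Real.pi / 3)) (2 * Real.pi / 3) := fun h =>
      ht ⟨lt_of_le_of_ne h.1 h1.symm, lt_of_le_of_ne h.2 h2⟩
    have e : flatProfileDeriv =ᶠ[nhds t] fun _ => 0 := by
      filter_upwards [isClosed_Icc.isOpen_compl.mem_nhds hn] with x hx
      exact flatProfileDeriv_eq_zero fun h => hx (Ioo_subset_Icc_self h)
    exact (hasDerivAt_const t (0 : ℝ)).congr_of_eventuallyEq e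

/-- The second derivative blows up at the edges, but it is at least `-1` because the profile is at
most `1`. Adding `1` makes it the nonnegative derivative of a continuous function, hence integrable.
-/
theorem integrable_flatProfileDeriv₂ : Integrable flatProfileDeriv₂ := by
  have h : IntegrableOn (fun t => 1 / (4 * √(flatProfile t)) - flatProfile t + 1)
      (Ioc (-(2 * Real.pi / 3)) (2 * Real.pi / 3)) := by
    refine intervalIntegral.integrableOn_deriv_of_nonneg (g := fun t => flatProfileDeriv t + t)
      (continuous_flatProfileDeriv.add continuous_id).continuousOn
      (fun t ht => (hasDerivAt_flatProfileDeriv ht).add (hasDerivAt_id t)) fun t _ => ?_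
    have := flatProfile_le_one t
    have : 0 ≤ 1 / (4 * √(flatProfile t)) := by positivity
    linarith
  have h2 : IntegrableOn (fun t => 1 / (4 * √(flatProfile t)) - flatProfile t)
      (Ioo (-(2 * Real.pi / 3)) (2 * Real.pi / 3)) := by
    have h3 : IntegrableOn (fun _ => (1 : ℝ)) (Ioo (-(2 * Real.pi / 3)) (2 * Real.pi / 3)) :=
      integrableOn_const (by simp)
    exact ((h.mono_set Ioo_subset_Ioc_self).sub h3).congr_fun
      (fun t _ => by simp) measurableSet_Ioo
  exact (integrable_indicator_iff measurableSet_Ioo).2 h2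

/-! ### Arcs: uniqueness, energy, and reduction to a profile -/

/-- `U`, with derivative `U₁`, is a solution of `U'' = V₀ / √U - λ U` that is positive on `(a, b)`
and vanishes at `a` and `b`. -/
structure IsArc (V₀ lam a b : ℝ) (U U₁ : ℝ → ℝ) : Prop where
  lt : a < b
  continuousOn : ContinuousOn U (Icc a b)
  left : U a = 0
  right : U b = 0
  pos : ∀ x ∈ Ioo a b, 0 < U x
  hasDerivAt : ∀ x ∈ Ioo a b, HasDerivAt U (U₁ x) x
  hasDerivAt_deriv : ∀ x ∈ Ioo a b, HasDerivAt U₁ (V₀ / √(U x) - lam * U x) x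

theorem mul_sub_mem_Ioo {c T r x : ℝ} (hr : 0 < r) (hx : x ∈ Ioo (c - T / r) (c + T / r)) :
    r * (x - c) ∈ Ioo (-T) T := by
  have e : r * (T / r) = T := by field_simp
  constructor <;> nlinarith [hx.1, hx.2]

theorem hasDerivAt_scaled {s : ℝ → ℝ} {s' r c x : ℝ} (M : ℝ)
    (h : HasDerivAt s s' (r * (x - c))) :
    HasDerivAt (fun x => M * s (r * (x - c))) (M * r * s') x := by
  have h1 : HasDerivAt (fun x : ℝ => r * (x - c)) r x := by
    simpa using ((hasDerivAt_id x).sub_const c).const_mul r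
  exact ((h.comp x h1).const_mul M).congr_deriv (by ring)

theorem IsProfile.isArc {k T : ℝ} {s s₁ : ℝ → ℝ} (h : IsProfile k T s s₁) {V₀ lam M : ℝ}
    (hlam : 0 < lam) (hM : 0 < M) (hk : lam * k * (M * √M) = 4 * V₀) (c : ℝ) :
    IsArc V₀ lam (c - T / √lam) (c + T / √lam) (fun x => M * s (√lam * (x - c)))
      (fun x => M * √lam * s₁ (√lam * (x - c))) := by
  have hr := Real.sqrt_pos.2 hlam
  have hT := h.period_pos
  have e : √lam * (T / √lam) = T := by field_simp
  refine ⟨?_, ?_, ?_, ?_, ?_, ?_, ?_⟩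
  · have : 0 < T / √lam := by positivity
    linarith
  · have := h.continuous
    fun_prop
  · rw [show √lam * (c - T / √lam - c) = -(√lam * (T / √lam)) by ring, e, h.apply_left, mul_zero]
  · rw [show √lam * (c + T / √lam - c) = √lam * (T / √lam) by ring, e, h.apply_right, mul_zero]
  · exact fun x hx => mul_pos hM (h.pos _ (mul_sub_mem_Ioo hr hx))
  · exact fun x hx => hasDerivAt_scaled M (h.hasDerivAt _ (Ioo_subset_Icc_self (mul_sub_mem_Ioo hr hx)))
  · intro x hx
    have hx' := mul_sub_mem_Ioo hr hx
    refine (hasDerivAt_scaled (M * √lam) (h.hasDerivAt_deriv _ hx')).congr_deriv ?_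
    have hs := Real.sqrt_pos.2 (h.pos _ hx')
    rw [Real.sqrt_mul hM.le]
    have hq := Real.sqrt_pos.2 hM
    have h1 := Real.sq_sqrt hM.le
    have h2 := Real.sq_sqrt hlam.le
    rw [show M * √lam * √lam = M * lam by rw [mul_assoc, ← sq, h2]]
    have h3 : M * lam * (k / (4 * √(s (√lam * (x - c))))) =
        V₀ / (√M * √(s (√lam * (x - c)))) := by
      rw [div_eq_mul_inv V₀, show V₀ = lam * k * (M * √M) / 4 by linarith]
      field_simp
    rw [mul_sub, h3]
    ring

/-- The vector field is singular at `u = 0`, so uniqueness is available only while both solutions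
stay above some `δ > 0`, which holds on compact subintervals. -/
theorem lipschitzOnWith_inv_sqrt (V₀ lam : ℝ) {δ : ℝ} (hδ : 0 < δ) :
    ∃ K, LipschitzOnWith K (fun p : ℝ × ℝ => (p.2, V₀ / √p.1 - lam * p.1)) {p | δ ≤ p.1} := by
  have h1 : LipschitzOnWith (Real.toNNReal (|V₀| * (1 / (2 * (δ * √δ))) + |lam|))
      (fun u : ℝ => V₀ / √u - lam * u) (Ici δ) := by
    have hd : ∀ u ∈ Ici δ, HasDerivWithinAt (fun u : ℝ => V₀ / √u - lam * u)
        (V₀ * (-(1 / (2 * √u)) / √u ^ 2) - lam) (Ici δ) u := by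
      intro u hu
      have hu0 : 0 < u := hδ.trans_le hu
      have h := ((Real.hasDerivAt_sqrt hu0.ne').inv (Real.sqrt_pos.2 hu0).ne').const_mul V₀
      have h' := (hasDerivAt_id u).const_mul lam
      rw [mul_one] at h'
      exact (h.sub h').hasDerivWithinAt
    refine (convex_Ici δ).lipschitzOnWith_of_nnnorm_hasDerivWithin_le hd fun u hu => ?_
    have hu0 : 0 < u := hδ.trans_le hu
    rw [← NNReal.coe_le_coe, coe_nnnorm, Real.coe_toNNReal _ (by positivity)]
    refine (norm_sub_le _ _).trans ?_
    rw [Real.norm_eq_abs, Real.norm_eq_abs, abs_mul, Real.sq_sqrt hu0.le]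
    gcongr
    rw [neg_div, abs_neg, div_div, abs_of_pos (by positivity)]
    have h1 : √δ ≤ √u := Real.sqrt_le_sqrt hu
    have h2 : δ ≤ u := hu
    rw [show 2 * √u * u = 2 * (u * √u) by ring]
    gcongr
  have h2 : LipschitzOnWith 1 (fun p : ℝ × ℝ => p.1) {p | δ ≤ p.1} :=
    LipschitzWith.prod_fst.lipschitzOnWith
  have h3 : LipschitzOnWith 1 (fun p : ℝ × ℝ => p.2) {p | δ ≤ p.1} :=
    LipschitzWith.prod_snd.lipschitzOnWith
  exact ⟨_, h3.prodMk (h1.comp h2 fun p hp => hp)⟩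

theorem eqOn_Icc_of_ode {V₀ lam c d x₀ : ℝ} {U U₁ V V₁ : ℝ → ℝ} (hx₀ : x₀ ∈ Ioo c d)
    (hU : ∀ x ∈ Icc c d, 0 < U x) (hV : ∀ x ∈ Icc c d, 0 < V x)
    (hU₁ : ∀ x ∈ Icc c d, HasDerivAt U (U₁ x) x) (hV₁ : ∀ x ∈ Icc c d, HasDerivAt V (V₁ x) x)
    (hU₂ : ∀ x ∈ Icc c d, HasDerivAt U₁ (V₀ / √(U x) - lam * U x) x)
    (hV₂ : ∀ x ∈ Icc c d, HasDerivAt V₁ (V₀ / √(V x) - lam * V x) x)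
    (h : U x₀ = V x₀) (h₁ : U₁ x₀ = V₁ x₀) : EqOn U V (Icc c d) := by
  have hne : (Icc c d).Nonempty := ⟨x₀, Ioo_subset_Icc_self hx₀⟩
  have cU : ContinuousOn U (Icc c d) := fun x hx => (hU₁ x hx).continuousAt.continuousWithinAt
  have cV : ContinuousOn V (Icc c d) := fun x hx => (hV₁ x hx).continuousAt.continuousWithinAt
  have cU₁ : ContinuousOn U₁ (Icc c d) := fun x hx => (hU₂ x hx).continuousAt.continuousWithinAt
  have cV₁ : ContinuousOn V₁ (Icc c d) := fun x hx => (hV₂ x hx).continuousAt.continuousWithinAt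
  obtain ⟨y, hy, hy'⟩ := isCompact_Icc.exists_isMinOn hne cU
  obtain ⟨z, hz, hz'⟩ := isCompact_Icc.exists_isMinOn hne cV
  obtain ⟨K, hK⟩ := lipschitzOnWith_inv_sqrt V₀ lam (lt_min (hU y hy) (hV z hz))
  have key := ODE_solution_unique_of_mem_Icc
    (v := fun _ p => (p.2, V₀ / √p.1 - lam * p.1)) (s := fun _ => {p | min (U y) (V z) ≤ p.1})
    (f := fun x => (U x, U₁ x)) (g := fun x => (V x, V₁ x)) (a := c) (b := d) (t₀ := x₀) (K := K)
    (fun _ _ => hK) hx₀ (cU.prodMk cU₁)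
    (fun x hx => (hU₁ x (Ioo_subset_Icc_self hx)).prodMk (hU₂ x (Ioo_subset_Icc_self hx)))
    (fun x hx => show min (U y) (V z) ≤ U x from
      (min_le_left _ _).trans (hy' (Ioo_subset_Icc_self hx)))
    (cV.prodMk cV₁)
    (fun x hx => (hV₁ x (Ioo_subset_Icc_self hx)).prodMk (hV₂ x (Ioo_subset_Icc_self hx)))
    (fun x hx => show min (U y) (V z) ≤ V x from
      (min_le_right _ _).trans (hz' (Ioo_subset_Icc_self hx)))
    (by simp [h, h₁])
  exact fun x hx => congrArg Prod.fst (key hx)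

/-- The arcs agree on the common part of their intervals, up to its ends by continuity. If the
endpoints differed, one arc would vanish at a point where the other is positive. -/
theorem IsArc.eq_of_eq {V₀ lam a b a' b' x₀ : ℝ} {U U₁ V V₁ : ℝ → ℝ} (hU : IsArc V₀ lam a b U U₁)
    (hV : IsArc V₀ lam a' b' V V₁) (hx : x₀ ∈ Ioo a b) (hx' : x₀ ∈ Ioo a' b')
    (h : U x₀ = V x₀) (h₁ : U₁ x₀ = V₁ x₀) : a = a' ∧ b = b' ∧ EqOn U V (Icc a b) := by
  have ha := max_lt hx.1 hx'.1
  have hb := lt_min hx.2 hx'.2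
  have key : EqOn U V (Ioo (max a a') (min b b')) := by
    intro y hy
    obtain ⟨c, hc1, hc2⟩ := exists_between (lt_min ha hy.1)
    obtain ⟨d, hd1, hd2⟩ := exists_between (max_lt hb hy.2)
    have hs : Icc c d ⊆ Ioo a b := fun x hx => ⟨((le_max_left _ _).trans_lt hc1).trans_le hx.1,
      hx.2.trans_lt (hd2.trans_le (min_le_left _ _))⟩
    have hs' : Icc c d ⊆ Ioo a' b' := fun x hx => ⟨((le_max_right _ _).trans_lt hc1).trans_le hx.1,
      hx.2.trans_lt (hd2.trans_le (min_le_right _ _))⟩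
    exact eqOn_Icc_of_ode (x₀ := x₀)
      ⟨hc2.trans_le (min_le_left _ _), (le_max_left _ _).trans_lt hd1⟩
      (fun x hx => hU.pos x (hs hx)) (fun x hx => hV.pos x (hs' hx))
      (fun x hx => hU.hasDerivAt x (hs hx)) (fun x hx => hV.hasDerivAt x (hs' hx))
      (fun x hx => hU.hasDerivAt_deriv x (hs hx)) (fun x hx => hV.hasDerivAt_deriv x (hs' hx)) h h₁
      ⟨(hc2.trans_le (min_le_right _ _)).le, ((le_max_right _ _).trans_lt hd1).le⟩
  have hlt := ha.trans hb
  have key' : EqOn U V (Icc (max a a') (min b b')) := by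
    rw [← closure_Ioo hlt.ne]
    refine key.of_subset_closure ?_ ?_ subset_closure le_rfl
    · rw [closure_Ioo hlt.ne]
      exact hU.continuousOn.mono (Icc_subset_Icc (le_max_left _ _) (min_le_left _ _))
    · rw [closure_Ioo hlt.ne]
      exact hV.continuousOn.mono (Icc_subset_Icc (le_max_right _ _) (min_le_right _ _))
  have el := key' (left_mem_Icc.2 hlt.le)
  have er := key' (right_mem_Icc.2 hlt.le)
  have haa : a = a' := by
    rcases lt_trichotomy a a' with hl | hl | hl
    · rw [max_eq_right hl.le, hV.left] at el
      exact absurd el (hU.pos a' ⟨hl, hx'.1.trans hx.2⟩).ne'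
    · exact hl
    · rw [max_eq_left hl.le, hU.left] at el
      exact absurd el.symm (hV.pos a ⟨hl, hx.1.trans hx'.2⟩).ne'
  have hbb : b = b' := by
    rcases lt_trichotomy b b' with hl | hl | hl
    · rw [min_eq_left hl.le, hU.right] at er
      exact absurd er.symm (hV.pos b ⟨hx'.1.trans hx.2, hl⟩).ne'
    · exact hl
    · rw [min_eq_right hl.le, hV.right] at er
      exact absurd er (hU.pos b' ⟨hx.1.trans hx'.2, hl⟩).ne'
  refine ⟨haa, hbb, ?_⟩
  rwa [haa, hbb, max_self, min_self, ← haa, ← hbb] at key'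

/-- The energy `U'²/2 - 2V₀√U + λU²/2` is conserved. Comparing its value at the maximum with the
limit at an end, where `U = 0`, gives the inequality, which is `k ≤ 1` in terms of the parameter. -/
theorem IsArc.exists_max {V₀ lam a b : ℝ} {U U₁ : ℝ → ℝ}
    (hU : IsArc V₀ lam a b U U₁) :
    ∃ x₀ ∈ Ioo a b, U₁ x₀ = 0 ∧ 4 * V₀ * √(U x₀) ≤ lam * U x₀ ^ 2 := by
  obtain ⟨x₀, hx₀, hmax⟩ := isCompact_Icc.exists_isMaxOn (nonempty_Icc.2 hU.lt.le) hU.continuousOn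
  have hm : (a + b) / 2 ∈ Ioo a b := ⟨by linarith [hU.lt], by linarith [hU.lt]⟩
  have hpos : 0 < U x₀ := (hU.pos _ hm).trans_le (hmax (Ioo_subset_Icc_self hm))
  have hx : x₀ ∈ Ioo a b := by
    refine ⟨lt_of_le_of_ne hx₀.1 ?_, lt_of_le_of_ne hx₀.2 ?_⟩
    · rintro rfl
      exact hpos.ne' hU.left
    · rintro rfl
      exact hpos.ne' hU.right
  have hz : U₁ x₀ = 0 :=
    (hmax.isLocalMax (Icc_mem_nhds hx.1 hx.2)).hasDerivAt_eq_zero (hU.hasDerivAt x₀ hx)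
  refine ⟨x₀, hx, hz, ?_⟩
  have hd : ∀ x ∈ Ioo a b,
      HasDerivAt (fun x => U₁ x ^ 2 / 2 - 2 * V₀ * √(U x) + lam * U x ^ 2 / 2) 0 x := by
    intro x hx
    have h1 := hU.hasDerivAt x hx
    have h2 := hU.hasDerivAt_deriv x hx
    have hs := Real.sqrt_pos.2 (hU.pos x hx)
    refine ((((h2.pow 2).div_const 2).sub ((h1.sqrt (hU.pos x hx).ne').const_mul (2 * V₀))).add
      (((h1.pow 2).const_mul lam).div_const 2)).congr_deriv ?_
    field_simp
    ring
  have hconst : ∀ x ∈ Ioo a b, U₁ x ^ 2 / 2 - 2 * V₀ * √(U x) + lam * U x ^ 2 / 2 =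
      -(2 * V₀ * √(U x₀)) + lam * U x₀ ^ 2 / 2 := by
    intro x hx'
    have := isOpen_Ioo.is_const_of_deriv_eq_zero isPreconnected_Ioo
      (fun y hy => (hd y hy).differentiableAt.differentiableWithinAt)
      (fun y hy => (hd y hy).deriv) hx' hx
    rw [this, hz]
    ring
  -- Nothing is known about `U₁` at `b`. Dropping the square of `U₁` leaves an inequality in `U`
  -- alone, which passes to the endpoint by continuity.
  have hle : -(2 * V₀ * √(U b)) + lam * U b ^ 2 / 2 ≤
      -(2 * V₀ * √(U x₀)) + lam * U x₀ ^ 2 / 2 := by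
    refine le_on_closure (s := Ioo a b) (f := fun x => -(2 * V₀ * √(U x)) + lam * U x ^ 2 / 2)
      (g := fun _ => -(2 * V₀ * √(U x₀)) + lam * U x₀ ^ 2 / 2) (x := b) (fun x hx' => ?_) ?_ continuousOn_const ?_
    · have := hconst x hx'
      have h3 : 0 ≤ U₁ x ^ 2 := sq_nonneg _
      linarith
    · rw [closure_Ioo hU.lt.ne]
      have := hU.continuousOn
      fun_prop
    · rw [closure_Ioo hU.lt.ne]
      exact right_mem_Icc.2 hU.lt.le
  simp only [hU.right, Real.sqrt_zero] at hle
  linarith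

/-- The maximum of the solution with parameter `k`. -/
noncomputable def amplitude (V₀ lam k : ℝ) : ℝ := (4 * V₀ / (lam * k)) ^ (2 / 3 : ℝ)

theorem amplitude_pos {V₀ lam k : ℝ} (hV₀ : 0 < V₀) (hlam : 0 < lam) (hk : 0 < k) :
    0 < amplitude V₀ lam k := by unfold amplitude; positivity

theorem rpow_two_thirds_mul_sqrt {q : ℝ} (hq : 0 ≤ q) :
    q ^ (2 / 3 : ℝ) * √(q ^ (2 / 3 : ℝ)) = q := by
  obtain ⟨w, hw, rfl⟩ : ∃ w, 0 ≤ w ∧ q = w ^ 3 :=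
    ⟨q ^ (1 / 3 : ℝ), by positivity, by
      rw [← Real.rpow_natCast, ← Real.rpow_mul hq]; norm_num⟩
  have : (w ^ 3) ^ (2 / 3 : ℝ) = w ^ 2 := by
    rw [← Real.rpow_natCast, ← Real.rpow_mul hw, ← Real.rpow_natCast]; norm_num
  rw [this, Real.sqrt_sq hw]
  ring

theorem amplitude_mul_sqrt {V₀ lam k : ℝ} (hV₀ : 0 < V₀) (hlam : 0 < lam) (hk : 0 < k) :
    lam * k * (amplitude V₀ lam k * √(amplitude V₀ lam k)) = 4 * V₀ := by
  rw [amplitude, rpow_two_thirds_mul_sqrt (by positivity)]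
  field_simp

theorem rpow_two_thirds_of_mul_sqrt {M : ℝ} (hM : 0 ≤ M) : (M * √M) ^ (2 / 3 : ℝ) = M := by
  obtain ⟨w, hw, rfl⟩ : ∃ w, 0 ≤ w ∧ M = w ^ 2 := ⟨√M, Real.sqrt_nonneg _, (Real.sq_sqrt hM).symm⟩
  rw [Real.sqrt_sq hw, show w ^ 2 * w = w ^ 3 by ring, ← Real.rpow_natCast, ← Real.rpow_mul hw,
    ← Real.rpow_natCast]
  norm_num

/-- At its maximum the arc has the same data as the rescaled profile with `k = 4V₀/(λ M^(3/2))`. The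
energy inequality forces `λ > 0` and `k ≤ 1`. The profile is left arbitrary so that `flatProfile`,
which is zero outside its interval, can be used when `k = 1`. -/
theorem IsArc.eq_model {V₀ lam a b : ℝ} {U U₁ : ℝ → ℝ} (hV₀ : 0 < V₀)
    (hU : IsArc V₀ lam a b U U₁) : 0 < lam ∧ ∃ k ∈ Ioc (0 : ℝ) 1, ∃ c,
      a = c - halfPeriod k / √lam ∧ b = c + halfPeriod k / √lam ∧
      ∀ s s₁, IsProfile k (halfPeriod k) s s₁ →
        EqOn U (fun x => amplitude V₀ lam k * s (√lam * (x - c))) (Icc a b) := by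
  obtain ⟨c, hc, hc1, hle⟩ := hU.exists_max
  have hM := hU.pos c hc
  have hq := Real.sqrt_pos.2 hM
  have hlam : 0 < lam := by
    by_contra hn
    have h1 : lam * U c ^ 2 ≤ 0 := mul_nonpos_of_nonpos_of_nonneg (not_lt.1 hn) (sq_nonneg _)
    have h2 : 0 < 4 * V₀ * √(U c) := by positivity
    linarith
  set M := U c with hMdef
  have hsq := Real.sq_sqrt hM.le
  have hk0 : 0 < 4 * V₀ / (lam * (M * √M)) := by positivity
  have hk1 : 4 * V₀ / (lam * (M * √M)) ≤ 1 := by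
    rw [div_le_one (by positivity)]
    have : 4 * V₀ * √M ≤ lam * (M * √M) * √M := by
      rw [show lam * (M * √M) * √M = lam * (M * √M ^ 2) by ring, hsq]
      linarith
    exact le_of_mul_le_mul_right this hq
  set k := 4 * V₀ / (lam * (M * √M)) with hk
  have hamp : amplitude V₀ lam k = M := by
    rw [amplitude, show 4 * V₀ / (lam * k) = M * √M by rw [hk]; field_simp,
      rpow_two_thirds_of_mul_sqrt hM.le]
  have key : ∀ s s₁, IsProfile k (halfPeriod k) s s₁ →
      a = c - halfPeriod k / √lam ∧ b = c + halfPeriod k / √lam ∧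
        EqOn U (fun x => M * s (√lam * (x - c))) (Icc a b) := by
    intro s s₁ hs
    have harc := hs.isArc (V₀ := V₀) hlam hM (by rw [hk]; field_simp) c
    refine hU.eq_of_eq harc hc ?_ ?_ ?_
    · have : 0 < halfPeriod k / √lam := div_pos hs.period_pos (Real.sqrt_pos.2 hlam)
      exact ⟨by linarith, by linarith⟩
    · simp [hs.apply_zero, hMdef]
    · simp [hs.deriv_zero, hc1]
  obtain ⟨s, s₁, hs⟩ := exists_isProfile hk0 hk1
  refine ⟨hlam, k, ⟨hk0, hk1⟩, c, (key s s₁ hs).1, (key s s₁ hs).2.1, fun s s₁ hs => ?_⟩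
  rw [hamp]
  exact (key s s₁ hs).2.2

/-! ### From classical to weak solutions and back -/

theorem absolutelyContinuousOnInterval_congr {f g : ℝ → ℝ} {a b : ℝ}
    (hf : AbsolutelyContinuousOnInterval f a b) (h : EqOn f g (uIcc a b)) :
    AbsolutelyContinuousOnInterval g a b := by
  rw [absolutelyContinuousOnInterval_iff] at hf ⊢
  intro ε hε
  obtain ⟨δ, hδ, H⟩ := hf ε hε
  refine ⟨δ, hδ, fun E hE hs => ?_⟩
  have := H E hE hs
  rwa [Finset.sum_congr rfl fun i hi => by rw [h (hE.1 i hi).1, h (hE.1 i hi).2]] at this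

/-- The fundamental theorem of calculus tolerates a countable exceptional set; for sums of bumps
this set consists of the edges. -/
theorem absolutelyContinuousOnInterval_of_hasDerivAt {g g' : ℝ → ℝ} {a b : ℝ} {S : Set ℝ}
    (hS : S.Countable) (hc : ContinuousOn g (uIcc a b))
    (hd : ∀ x ∈ uIcc a b, x ∉ S → HasDerivAt g (g' x) x) (hi : IntervalIntegrable g' volume a b) :
    AbsolutelyContinuousOnInterval g a b := by
  have h1 := hi.absolutelyContinuousOnInterval_intervalIntegral (c := a) left_mem_uIcc
  have h2 : AbsolutelyContinuousOnInterval (fun _ : ℝ => g a) a b :=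
    (LipschitzWith.const (g a)).lipschitzOnWith.absolutelyContinuousOnInterval
  refine absolutelyContinuousOnInterval_congr (h2.add h1) fun x hx => ?_
  have hsub : uIcc a x ⊆ uIcc a b := uIcc_subset_uIcc left_mem_uIcc hx
  have := integral_eq_of_hasDerivAt_off_countable g g' hS (hc.mono hsub)
    (fun y hy => hd y (hsub (Ioo_subset_Icc_self hy.1)) hy.2)
    (hi.mono_set hsub)
  simp only [Pi.add_apply]
  rw [this]
  ring

theorem uIcc_subset_Ioo {a b c d : ℝ} (ha : a ∈ Ioo c d) (hb : b ∈ Ioo c d) :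
    uIcc a b ⊆ Ioo c d :=
  (ordConnected_Ioo).uIcc_subset ha hb

theorem isNonnegSolution_of_hasDerivAt {V₀ R lam : ℝ} {U U₁ U₂ : ℝ → ℝ} {S : Set ℝ}
    (hS : S.Countable) (hc : ContinuousOn U (Icc (-R) R)) (h0 : ∀ x ∈ Icc (-R) R, 0 ≤ U x)
    (hl : U (-R) = 0) (hr : U R = 0) (h1 : ∀ x ∈ Ioo (-R) R, HasDerivAt U (U₁ x) x)
    (hc₁ : ContinuousOn U₁ (Ioo (-R) R))
    (h2 : ∀ x ∈ Ioo (-R) R, x ∉ S → HasDerivAt U₁ (U₂ x) x)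
    (hi : ∀ a ∈ Ioo (-R) R, ∀ b ∈ Ioo (-R) R, IntervalIntegrable U₂ volume a b)
    (heq : ∀ x ∈ Ioo (-R) R, x ∉ S → -U₂ x + absorption V₀ U x = lam * U x) :
    IsNonnegSolution V₀ R lam U := by
  have hd : EqOn U₁ (deriv U) (Ioo (-R) R) := fun x hx => (h1 x hx).deriv.symm
  refine ⟨hc, h0, hl, hr, fun x hx => (h1 x hx).differentiableAt, fun a ha b hb => ?_, ?_⟩
  · have hs := uIcc_subset_Ioo ha hb
    exact absolutelyContinuousOnInterval_congr
      (absolutelyContinuousOnInterval_of_hasDerivAt hS (hc₁.mono hs)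
        (fun x hx => h2 x (hs hx)) (hi a ha b hb)) (hd.mono hs)
  · have hae : ∀ᵐ x ∂(volume : Measure ℝ), x ∉ S := hS.ae_notMem volume
    rw [ae_restrict_iff' measurableSet_Ioo]
    filter_upwards [hae] with x hxS hx
    have e : deriv U =ᶠ[nhds x] U₁ := by
      filter_upwards [Ioo_mem_nhds hx.1 hx.2] with y hy using (hd hy).symm
    rw [e.deriv_eq, (h2 x hx hxS).deriv]
    exact heq x hx hxS

theorem IsNonnegSolution.congr {V₀ R lam : ℝ} {U u : ℝ → ℝ} (hR : 0 < R)
    (h : IsNonnegSolution V₀ R lam u) (e : EqOn U u (Icc (-R) R)) :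
    IsNonnegSolution V₀ R lam U := by
  have e1 : ∀ x ∈ Ioo (-R) R, U =ᶠ[nhds x] u := fun x hx => by
    filter_upwards [Icc_mem_nhds hx.1 hx.2] with y hy using e hy
  have e2 : EqOn (deriv u) (deriv U) (Ioo (-R) R) := fun x hx => (e1 x hx).deriv_eq.symm
  refine ⟨h.continuousOn.congr e, fun x hx => by rw [e hx]; exact h.nonneg x hx,
    by rw [e (left_mem_Icc.2 (by linarith)), h.left_eq_zero],
    by rw [e (right_mem_Icc.2 (by linarith)), h.right_eq_zero],
    fun x hx => (h.differentiableAt x hx).congr_of_eventuallyEq (e1 x hx),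
    fun a ha b hb => absolutelyContinuousOnInterval_congr
      (h.deriv_absolutelyContinuous a ha b hb) (e2.mono (uIcc_subset_Ioo ha hb)), ?_⟩
  have := h.equation
  rw [ae_restrict_iff' measurableSet_Ioo] at this ⊢
  filter_upwards [this] with x hx hxR
  have e3 : deriv U =ᶠ[nhds x] deriv u := by
    filter_upwards [Ioo_mem_nhds hxR.1 hxR.2] with y hy using (e2 hy).symm
  have e4 := hx hxR
  rw [e3.deriv_eq, e (Ioo_subset_Icc_self hxR)]
  rwa [absorption, (e1 x hxR).eq_of_nhds]

theorem IsArc.isPositiveSolution {V₀ R lam : ℝ} {U U₁ : ℝ → ℝ} (h : IsArc V₀ lam (-R) R U U₁) :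
    IsPositiveSolution V₀ R lam U := by
  refine ⟨isNonnegSolution_of_hasDerivAt (U₁ := U₁) (U₂ := fun x => V₀ / √(U x) - lam * U x)
    countable_empty h.continuousOn ?_ h.left h.right h.hasDerivAt
    (fun x hx => (h.hasDerivAt_deriv x hx).continuousAt.continuousWithinAt)
    (fun x hx _ => h.hasDerivAt_deriv x hx) ?_ ?_, h.pos⟩
  · intro x hx
    rcases eq_or_lt_of_le hx.1 with rfl | h1
    · exact h.left.ge
    rcases eq_or_lt_of_le hx.2 with rfl | h2
    · exact h.right.ge
    exact (h.pos x ⟨h1, h2⟩).le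
  · intro a ha b hb
    have hs := uIcc_subset_Ioo ha hb
    have hc : ContinuousOn U (uIcc a b) := fun x hx =>
      (h.hasDerivAt x (hs hx)).continuousAt.continuousWithinAt
    refine ContinuousOn.intervalIntegrable ?_
    exact (continuousOn_const.div hc.sqrt fun x hx => (Real.sqrt_pos.2 (h.pos x (hs hx))).ne').sub
      (continuousOn_const.mul hc)
  · intro x hx _
    rw [absorption, if_pos (h.pos x hx)]
    ring

/-- Where `U > 0` the absolutely continuous `U'` is the integral of a function that is continuous
there, so the almost everywhere equation holds at every point. -/
theorem IsNonnegSolution.hasDerivAt_deriv {V₀ R lam a b : ℝ} {U : ℝ → ℝ}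
    (hU : IsNonnegSolution V₀ R lam U) (ha : -R ≤ a) (hb : b ≤ R) (hpos : ∀ x ∈ Ioo a b, 0 < U x)
    {x : ℝ} (hx : x ∈ Ioo a b) : HasDerivAt (deriv U) (V₀ / √(U x) - lam * U x) x := by
  have hsub : Ioo a b ⊆ Ioo (-R) R := Ioo_subset_Ioo ha hb
  have hc : ContinuousOn U (Ioo a b) := fun y hy =>
    (hU.differentiableAt y (hsub hy)).continuousAt.continuousWithinAt
  have hg : ContinuousOn (fun y => V₀ / √(U y) - lam * U y) (Ioo a b) :=
    (continuousOn_const.div hc.sqrt fun y hy => (Real.sqrt_pos.2 (hpos y hy)).ne').sub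
      (continuousOn_const.mul hc)
  have key : ∀ y ∈ Ioo a b,
      deriv U y = deriv U x + ∫ t in x..y, (V₀ / √(U t) - lam * U t) := by
    intro y hy
    have hs := uIcc_subset_Ioo hx hy
    have h1 := (hU.deriv_absolutelyContinuous x (hsub hx) y (hsub hy)).integral_deriv_eq_sub
    have h2 : ∫ t in x..y, deriv (deriv U) t = ∫ t in x..y, (V₀ / √(U t) - lam * U t) := by
      refine intervalIntegral.integral_congr_ae ?_
      have := hU.equation
      rw [ae_restrict_iff' measurableSet_Ioo] at this
      filter_upwards [this] with t ht htu
      have ht' := hs (uIoc_subset_uIcc htu)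
      have h3 := ht (hsub ht')
      rw [absorption, if_pos (hpos t ht')] at h3
      linarith
    rw [← h2, h1]
    ring
  have hd : HasDerivAt (fun y => deriv U x + ∫ t in x..y, (V₀ / √(U t) - lam * U t))
      (V₀ / √(U x) - lam * U x) x :=
    (intervalIntegral.integral_hasDerivAt_right (by simp)
      (hg.stronglyMeasurableAtFilter isOpen_Ioo x hx)
      (hg.continuousAt (Ioo_mem_nhds hx.1 hx.2))).const_add _
  refine hd.congr_of_eventuallyEq ?_
  filter_upwards [Ioo_mem_nhds hx.1 hx.2] with y hy using key y hy

/-! ### Decomposition of a nonnegative solution into arcs -/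

theorem IsNonnegSolution.exists_isArc {V₀ R lam x : ℝ} {U : ℝ → ℝ}
    (hU : IsNonnegSolution V₀ R lam U) (hx : x ∈ Icc (-R) R) (hpos : 0 < U x) :
    ∃ a b, -R ≤ a ∧ b ≤ R ∧ x ∈ Ioo a b ∧ IsArc V₀ lam a b U (deriv U) := by
  -- The ends of the arc are the nearest zeros of `U` on either side of `x`. They exist by
  -- compactness, the boundary values making the zero sets nonempty.
  have hcl : ∀ {c d}, -R ≤ c → d ≤ R → IsCompact (Icc c d ∩ U ⁻¹' {0}) := fun {c d} hc hd =>
    isCompact_Icc.of_isClosed_subset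
      ((hU.continuousOn.mono (Icc_subset_Icc hc hd)).preimage_isClosed_of_isClosed
        isClosed_Icc isClosed_singleton) inter_subset_left
  obtain ⟨a, ⟨ha, ha0⟩, ha'⟩ := (hcl le_rfl hx.2).exists_isGreatest
    ⟨-R, left_mem_Icc.2 hx.1, hU.left_eq_zero⟩
  obtain ⟨b, ⟨hb, hb0⟩, hb'⟩ := (hcl hx.1 le_rfl).exists_isLeast
    ⟨R, right_mem_Icc.2 hx.2, hU.right_eq_zero⟩
  have hax : a < x := lt_of_le_of_ne ha.2 (by rintro rfl; exact hpos.ne' ha0)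
  have hxb : x < b := lt_of_le_of_ne hb.1 (by rintro rfl; exact hpos.ne' hb0)
  have hp : ∀ y ∈ Ioo a b, 0 < U y := by
    intro y hy
    refine lt_of_le_of_ne (hU.nonneg y ⟨ha.1.trans hy.1.le, hy.2.le.trans hb.2⟩) fun h => ?_
    rcases le_total y x with h1 | h1
    · exact (ha' ⟨⟨ha.1.trans hy.1.le, h1⟩, h.symm⟩).not_gt hy.1
    · exact (hb' ⟨⟨h1, hy.2.le.trans hb.2⟩, h.symm⟩).not_gt hy.2
  exact ⟨a, b, ha.1, hb.2, ⟨hax, hxb⟩, hax.trans hxb,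
    hU.continuousOn.mono (Icc_subset_Icc ha.1 hb.2), ha0, hb0, hp,
    fun y hy => (hU.differentiableAt y (Ioo_subset_Ioo ha.1 hb.2 hy)).hasDerivAt,
    fun y hy => hU.hasDerivAt_deriv ha.1 hb.2 hp hy⟩

theorem IsNonnegSolution.deriv_eq_zero {V₀ R lam a : ℝ} {U : ℝ → ℝ}
    (hU : IsNonnegSolution V₀ R lam U) (ha : a ∈ Ioo (-R) R) (h0 : U a = 0) :
    HasDerivAt U 0 a := by
  have h1 : IsLocalMin U a := by
    filter_upwards [Icc_mem_nhds ha.1 ha.2] with y hy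
    rw [h0]
    exact hU.nonneg y hy
  have h2 := (hU.differentiableAt a ha).hasDerivAt
  rwa [h1.deriv_eq_zero] at h2

/-- The two functions agree only on one side of an endpoint `y`, so the derivatives are compared
within `[a, b]`, where they are still unique. -/
theorem eq_one_of_hasDerivAt_zero {U V : ℝ → ℝ} {a b y k q : ℝ} (hab : a < b) (hy : y ∈ Icc a b)
    (e : EqOn U V (Icc a b)) (hU : HasDerivAt U 0 y) (hV : HasDerivAt V (q * √(1 - k)) y)
    (hq : q ≠ 0) (hk : k ≤ 1) : k = 1 := by
  have h := (uniqueDiffOn_Icc hab y hy).eq_deriv _ (hU.hasDerivWithinAt.congr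
    (fun z hz => (e hz).symm) (e hy).symm) hV.hasDerivWithinAt
  have h2 : √(1 - k) = 0 := by
    rcases mul_eq_zero.1 h.symm with h | h
    · exact absurd h hq
    · exact h
  rw [Real.sqrt_eq_zero (by linarith)] at h2
  linarith

/-- Around each point of positivity, a solution is a translate of a model, and this model is the
flat one unless it fills the whole interval. -/
theorem IsNonnegSolution.exists_model {V₀ R lam x : ℝ} {U : ℝ → ℝ} (hV₀ : 0 < V₀)
    (hU : IsNonnegSolution V₀ R lam U) (hx : x ∈ Icc (-R) R) (hpos : 0 < U x) :
    0 < lam ∧ ∃ k ∈ Ioc (0 : ℝ) 1, ∃ c, -R ≤ c - halfPeriod k / √lam ∧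
      c + halfPeriod k / √lam ≤ R ∧
      x ∈ Ioo (c - halfPeriod k / √lam) (c + halfPeriod k / √lam) ∧
      U (c - halfPeriod k / √lam) = 0 ∧ U (c + halfPeriod k / √lam) = 0 ∧
      (∀ s s₁, IsProfile k (halfPeriod k) s s₁ →
        EqOn U (fun y => amplitude V₀ lam k * s (√lam * (y - c)))
          (Icc (c - halfPeriod k / √lam) (c + halfPeriod k / √lam))) ∧
      (k = 1 ∨ c = 0 ∧ halfPeriod k / √lam = R) := by
  obtain ⟨a, b, ha, hb, hxab, harc⟩ := hU.exists_isArc hx hpos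
  obtain ⟨hlam, k, hk, c, rfl, rfl, hmodel⟩ := harc.eq_model hV₀
  refine ⟨hlam, k, hk, c, ha, hb, hxab, harc.left, harc.right, hmodel, ?_⟩
  obtain ⟨s, s₁, hs⟩ := exists_isProfile hk.1 hk.2
  have e := hmodel s s₁ hs
  have hr := Real.sqrt_pos.2 hlam
  have hA := amplitude_pos hV₀ hlam hk.1
  have hT := hs.period_pos
  have er : √lam * (halfPeriod k / √lam) = halfPeriod k := by field_simp
  -- An end of the arc strictly inside `(-R, R)` is a minimum of `U`, so the slope of the model, a
  -- nonzero multiple of `√(1 - k)`, vanishes there.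
  rcases eq_or_lt_of_le ha with h1 | h1
  · rcases eq_or_lt_of_le hb with h2 | h2
    · exact Or.inr ⟨by linarith, by linarith⟩
    · left
      refine eq_one_of_hasDerivAt_zero (q := -(amplitude V₀ lam k * √lam)) harc.lt
        (right_mem_Icc.2 harc.lt.le) e
        (hU.deriv_eq_zero ⟨ha.trans_lt harc.lt, h2⟩ harc.right) ?_
        (by simp; constructor <;> positivity) hk.2
      have h3 : √lam * (c + halfPeriod k / √lam - c) = halfPeriod k := by
        rw [add_sub_cancel_left, er]
      have h4 := hasDerivAt_scaled (r := √lam) (c := c) (x := c + halfPeriod k / √lam)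
        (amplitude V₀ lam k) (by rw [h3]; exact hs.hasDerivAt _ (right_mem_Icc.2 (by linarith)))
      rw [hs.deriv_right] at h4
      exact h4.congr_deriv (by ring)
  · left
    refine eq_one_of_hasDerivAt_zero (q := amplitude V₀ lam k * √lam) harc.lt
      (left_mem_Icc.2 harc.lt.le) e
      (hU.deriv_eq_zero ⟨h1, harc.lt.trans_le hb⟩ harc.left) ?_ (by positivity) hk.2
    have h3 : √lam * (c - halfPeriod k / √lam - c) = -halfPeriod k := by
      rw [sub_sub_cancel_left, mul_neg, er]
    have h4 := hasDerivAt_scaled (r := √lam) (c := c) (x := c - halfPeriod k / √lam)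
      (amplitude V₀ lam k) (by rw [h3]; exact hs.hasDerivAt _ (left_mem_Icc.2 (by linarith)))
    rwa [hs.deriv_left] at h4

/-! ### Essential supremum and counting of components -/

theorem supNorm_eq {R M : ℝ} {U : ℝ → ℝ} (hc : ContinuousOn U (Ioo (-R) R))
    (h0 : ∀ x ∈ Ioo (-R) R, 0 ≤ U x) (hM : ∀ x ∈ Ioo (-R) R, U x ≤ M)
    (hx : ∃ x ∈ Ioo (-R) R, U x = M) : supNorm R U = ENNReal.ofReal M := by
  obtain ⟨x₀, hx₀, hx₀M⟩ := hx
  refine le_antisymm ?_ ?_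
  · rw [supNorm, eLpNorm_exponent_top]
    refine eLpNormEssSup_le_of_ae_bound ?_
    refine (ae_restrict_iff' measurableSet_Ioo).2 (.of_forall fun x hx => ?_)
    rw [Real.norm_of_nonneg (h0 x hx)]
    exact hM x hx
  · by_contra hlt
    rw [not_le] at hlt
    -- The set where `U` exceeds its essential supremum is open and null, hence empty; but it would
    -- contain the maximum point.
    have hopen : IsOpen (Ioo (-R) R ∩ (fun x => ENNReal.ofReal (U x)) ⁻¹' Ioi (supNorm R U)) :=
      (ENNReal.continuous_ofReal.comp_continuousOn hc).isOpen_inter_preimage isOpen_Ioo isOpen_Ioi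
    have hae : ∀ᵐ x ∂(volume.restrict (Ioo (-R) R)), ‖U x‖ₑ ≤ supNorm R U := by
      rw [supNorm, eLpNorm_exponent_top]
      exact ae_le_eLpNormEssSup
    rw [ae_restrict_iff' measurableSet_Ioo] at hae
    have hzero :
        volume (Ioo (-R) R ∩ (fun x => ENNReal.ofReal (U x)) ⁻¹' Ioi (supNorm R U)) = 0 := by
      rw [measure_eq_zero_iff_ae_notMem]
      filter_upwards [hae] with x hx hx'
      have h1 := hx hx'.1
      rw [Real.enorm_of_nonneg (h0 x hx'.1)] at h1
      exact h1.not_gt hx'.2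
    rw [hopen.measure_eq_zero_iff volume] at hzero
    have : x₀ ∈ (∅ : Set ℝ) := by
      rw [← hzero]
      exact ⟨hx₀, by simpa [hx₀M] using hlt⟩
    exact this

/-- Sending a point to the index of its set is continuous into a discrete space and has connected
fibres, so it descends to a bijection from the components. -/
theorem card_connectedComponents_of_isOpen {X : Type*} [TopologicalSpace X] {j : ℕ}
    {A : Fin j → Set X} (ho : ∀ i, IsOpen (A i)) (hc : ∀ i, IsConnected (A i))
    (hd : ∀ i k, i ≠ k → Disjoint (A i) (A k)) (hcov : ∀ x, ∃ i, x ∈ A i) :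
    Nat.card (ConnectedComponents X) = j := by
  choose f hf using hcov
  have hfi : ∀ {x i}, x ∈ A i → f x = i := fun {x i} hx => by
    by_contra hne
    exact (Set.disjoint_left.1 (hd _ _ hne)) (hf x) hx
  have hcont : Continuous f := by
    refine continuous_def.2 fun s _ => ?_
    have : f ⁻¹' s = ⋃ i ∈ s, A i := by
      ext x
      simp only [mem_preimage, mem_iUnion, exists_prop]
      exact ⟨fun h => ⟨f x, h, hf x⟩, fun ⟨i, hi, hx⟩ => by rwa [hfi hx]⟩
    rw [this]
    exact isOpen_biUnion fun i _ => ho i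
  have hbij : Function.Bijective hcont.connectedComponentsLift := by
    constructor
    · intro p q
      obtain ⟨x, rfl⟩ := ConnectedComponents.surjective_coe p
      obtain ⟨y, rfl⟩ := ConnectedComponents.surjective_coe q
      intro h
      rw [hcont.connectedComponentsLift_apply_coe, hcont.connectedComponentsLift_apply_coe] at h
      rw [ConnectedComponents.coe_eq_coe']
      exact (hc (f x)).isPreconnected.subset_connectedComponent (h ▸ hf y) (hf x)
    · intro i
      obtain ⟨x, hx⟩ := (hc i).nonempty
      exact ⟨x, by rw [hcont.connectedComponentsLift_apply_coe, hfi hx]⟩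
  rw [Nat.card_eq_of_bijective _ hbij, Nat.card_eq_fintype_card, Fintype.card_fin]

/-- The open case serves positivity sets, the closed case closed supports. Finitely many disjoint
closed sets are relatively open in their union. -/
theorem card_connectedComponents_iUnion {X : Type*} [TopologicalSpace X] {j : ℕ}
    {B : Fin j → Set X} {S : Set X} (hS : S = ⋃ i, B i)
    (ho : (∀ i, IsOpen (B i)) ∨ ∀ i, IsClosed (B i))
    (hc : ∀ i, IsConnected (B i)) (hd : ∀ i k, i ≠ k → Disjoint (B i) (B k)) :
    Nat.card (ConnectedComponents S) = j := by
  subst hS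
  have hcov : ∀ x : ⋃ i, B i, ∃ i, x ∈ ((↑) : (⋃ i, B i) → X) ⁻¹' B i := fun x =>
    (mem_iUnion.1 x.2 : ∃ i, (x : X) ∈ B i)
  have hd' : ∀ i k, i ≠ k → Disjoint (((↑) : (⋃ i, B i) → X) ⁻¹' B i) ((↑) ⁻¹' B k) :=
    fun i k hik => (hd i k hik).preimage _
  refine card_connectedComponents_of_isOpen (A := fun i => (↑) ⁻¹' B i) (fun i => ?_) (fun i => ?_)
    hd' hcov
  · rcases ho with ho | ho
    · exact (ho i).preimage continuous_subtype_val
    · have : (((↑) : (⋃ i, B i) → X) ⁻¹' B i)ᶜ =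
          ⋃ k ∈ {k | k ≠ i}, ((↑) : (⋃ i, B i) → X) ⁻¹' B k := by
        ext x
        simp only [mem_compl_iff, mem_iUnion, exists_prop, mem_ofPred_eq]
        constructor
        · intro hx
          obtain ⟨k, hk⟩ := hcov x
          exact ⟨k, by rintro rfl; exact hx hk, hk⟩
        · rintro ⟨k, hk, hx⟩ hx'
          exact (Set.disjoint_left.1 (hd' k i hk)) hx hx'
      rw [← isClosed_compl_iff, this]
      exact (Set.toFinite _).isClosed_biUnion fun k _ => (ho k).preimage continuous_subtype_val
  · have himg : ((↑) : (⋃ i, B i) → X) '' ((↑) ⁻¹' B i) = B i := by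
      rw [Subtype.image_preimage_coe, inter_eq_right]
      exact subset_iUnion B i
    constructor
    · obtain ⟨x, hx⟩ := (hc i).nonempty
      exact ⟨⟨x, mem_iUnion.2 ⟨i, hx⟩⟩, hx⟩
    · rw [← Topology.IsInducing.subtypeVal.isPreconnected_image, himg]
      exact (hc i).isPreconnected

/-! ### Flat bumps and their disjoint sums -/

/-- Half the length of the positivity interval of a flat bump. -/
noncomputable def flatRadius (lam : ℝ) : ℝ := halfPeriod 1 / √lam

theorem flatRadius_pos {lam : ℝ} (hlam : 0 < lam) : 0 < flatRadius lam :=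
  div_pos isProfile_flat.period_pos (Real.sqrt_pos.2 hlam)

/-- The flat solution with centre `c`, extended by zero. -/
noncomputable def flatBump (V₀ lam c x : ℝ) : ℝ :=
  amplitude V₀ lam 1 * flatProfile (√lam * (x - c))

section FlatBump

variable {V₀ lam : ℝ}

theorem isArc_flatBump (hV₀ : 0 < V₀) (hlam : 0 < lam) (c : ℝ) :
    IsArc V₀ lam (c - flatRadius lam) (c + flatRadius lam) (flatBump V₀ lam c)
      (fun x => amplitude V₀ lam 1 * √lam * flatProfileDeriv (√lam * (x - c))) :=
  isProfile_flat.isArc hlam (amplitude_pos hV₀ hlam one_pos)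
    (amplitude_mul_sqrt hV₀ hlam one_pos) c

theorem flatBump_eq_zero (hlam : 0 < lam) {c x : ℝ}
    (hx : x ∉ Ioo (c - flatRadius lam) (c + flatRadius lam)) : flatBump V₀ lam c x = 0 := by
  rw [flatBump, flatProfile_eq_zero, mul_zero]
  rw [← halfPeriod_one]
  intro h
  apply hx
  have hr := Real.sqrt_pos.2 hlam
  have e : √lam * flatRadius lam = halfPeriod 1 := by rw [flatRadius]; field_simp
  rw [← e] at h
  constructor
  · have := lt_of_mul_lt_mul_left (a := √lam) (b := -flatRadius lam) (c := x - c)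
      (by linarith [h.1]) hr.le
    linarith
  · have := lt_of_mul_lt_mul_left h.2 hr.le
    linarith

theorem support_flatBump (hV₀ : 0 < V₀) (hlam : 0 < lam) (c : ℝ) :
    Function.support (flatBump V₀ lam c) = Ioo (c - flatRadius lam) (c + flatRadius lam) := by
  ext x
  constructor
  · intro h
    by_contra hx
    exact h (flatBump_eq_zero hlam hx)
  · exact fun h => ((isArc_flatBump hV₀ hlam c).pos x h).ne'

theorem flatBump_nonneg (hV₀ : 0 < V₀) (hlam : 0 < lam) (c x : ℝ) : 0 ≤ flatBump V₀ lam c x := by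
  by_cases hx : x ∈ Ioo (c - flatRadius lam) (c + flatRadius lam)
  · exact ((isArc_flatBump hV₀ hlam c).pos x hx).le
  · rw [flatBump_eq_zero hlam hx]

theorem continuous_flatBump (V₀ lam c : ℝ) : Continuous (flatBump V₀ lam c) := by
  have := continuous_flatProfile
  unfold flatBump
  fun_prop

theorem flatBump_le (hV₀ : 0 < V₀) (hlam : 0 < lam) (c x : ℝ) :
    flatBump V₀ lam c x ≤ amplitude V₀ lam 1 :=
  mul_le_of_le_one_right (amplitude_pos hV₀ hlam one_pos).le (flatProfile_le_one _)

theorem flatBump_self (V₀ lam c : ℝ) : flatBump V₀ lam c c = amplitude V₀ lam 1 := by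
  rw [flatBump, sub_self, mul_zero, isProfile_flat.apply_zero, mul_one]

theorem hasDerivAt_flatBump (c x : ℝ) : HasDerivAt (flatBump V₀ lam c)
    (amplitude V₀ lam 1 * √lam * flatProfileDeriv (√lam * (x - c))) x :=
  hasDerivAt_scaled _ (hasDerivAt_flatProfile _)

theorem hasDerivAt_flatBump_deriv (hlam : 0 < lam) {c x : ℝ} (h1 : x ≠ c - flatRadius lam)
    (h2 : x ≠ c + flatRadius lam) :
    HasDerivAt (fun x => amplitude V₀ lam 1 * √lam * flatProfileDeriv (√lam * (x - c)))
      (amplitude V₀ lam 1 * √lam * √lam * flatProfileDeriv₂ (√lam * (x - c))) x := by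
  have hr := Real.sqrt_pos.2 hlam
  have e : √lam * flatRadius lam = halfPeriod 1 := by rw [flatRadius]; field_simp
  refine hasDerivAt_scaled _ (hasDerivAt_flatProfileDeriv_off ?_ ?_) <;> rw [← halfPeriod_one, ← e]
  · intro h
    apply h1
    have := mul_left_cancel₀ hr.ne' (h.trans (mul_neg _ _).symm)
    linarith
  · intro h
    apply h2
    have := mul_left_cancel₀ hr.ne' h
    linarith

theorem flatBump_equation (hV₀ : 0 < V₀) (hlam : 0 < lam) {c x : ℝ} (h1 : x ≠ c - flatRadius lam)
    (h2 : x ≠ c + flatRadius lam) :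
    amplitude V₀ lam 1 * √lam * √lam * flatProfileDeriv₂ (√lam * (x - c)) =
      absorption V₀ (flatBump V₀ lam c) x - lam * flatBump V₀ lam c x := by
  have hd := hasDerivAt_flatBump_deriv (V₀ := V₀) hlam h1 h2
  by_cases hx : x ∈ Ioo (c - flatRadius lam) (c + flatRadius lam)
  · rw [absorption, if_pos ((isArc_flatBump hV₀ hlam c).pos x hx)]
    exact hd.unique ((isArc_flatBump hV₀ hlam c).hasDerivAt_deriv x hx)
  · have hn : x ∉ Icc (c - flatRadius lam) (c + flatRadius lam) := fun h =>
      hx ⟨lt_of_le_of_ne h.1 h1.symm, lt_of_le_of_ne h.2 h2⟩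
    have hz := flatBump_eq_zero (V₀ := V₀) hlam hx
    rw [absorption, hz, if_neg (lt_irrefl _), mul_zero, sub_zero]
    -- Away from the closed interval the bump vanishes identically near each point, so its first
    -- derivative does too, and then the second.
    refine hd.unique ((hasDerivAt_const x (0 : ℝ)).congr_of_eventuallyEq ?_)
    filter_upwards [isClosed_Icc.isOpen_compl.mem_nhds hn] with y hy
    have h3 : HasDerivAt (flatBump V₀ lam c) 0 y := by
      refine (hasDerivAt_const y (0 : ℝ)).congr_of_eventuallyEq ?_
      filter_upwards [isClosed_Icc.isOpen_compl.mem_nhds hy] with w hw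
      exact flatBump_eq_zero hlam fun h => hw (Ioo_subset_Icc_self h)
    exact (hasDerivAt_flatBump c y).unique h3

theorem integrable_flatBump_deriv₂ (hlam : 0 < lam) (c : ℝ) :
    Integrable fun x =>
      amplitude V₀ lam 1 * √lam * √lam * flatProfileDeriv₂ (√lam * (x - c)) :=
  ((integrable_flatProfileDeriv₂.comp_mul_left' (Real.sqrt_pos.2 hlam).ne').comp_sub_right
    c).const_mul _

/-- The sums of `j` flat bumps with disjoint positivity sets inside `(-R, R)`. -/
def flatFamily (V₀ R lam : ℝ) (j : ℕ) : Set (ℝ → ℝ) :=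
  {u | ∃ c : Fin j → ℝ,
    (∀ i, Ioo (c i - flatRadius lam) (c i + flatRadius lam) ⊆ Ioo (-R) R) ∧
    (∀ i k, i ≠ k → Disjoint (Ioo (c i - flatRadius lam) (c i + flatRadius lam))
      (Ioo (c k - flatRadius lam) (c k + flatRadius lam))) ∧
    u = fun x => ∑ i, flatBump V₀ lam (c i) x}

variable {j : ℕ} {c : Fin j → ℝ}

theorem sum_flatBump_of_mem (hlam : 0 < lam)
    (hd : ∀ i k, i ≠ k → Disjoint (Ioo (c i - flatRadius lam) (c i + flatRadius lam))
      (Ioo (c k - flatRadius lam) (c k + flatRadius lam))) {x : ℝ} {i : Fin j}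
    (hx : x ∈ Ioo (c i - flatRadius lam) (c i + flatRadius lam)) :
    ∑ i, flatBump V₀ lam (c i) x = flatBump V₀ lam (c i) x :=
  Finset.sum_eq_single i (fun k _ hki => flatBump_eq_zero hlam
    fun h => Set.disjoint_left.1 (hd k i hki) h hx) (by simp)

theorem sum_flatBump_of_notMem (hlam : 0 < lam) {x : ℝ}
    (hx : ∀ i, x ∉ Ioo (c i - flatRadius lam) (c i + flatRadius lam)) :
    ∑ i, flatBump V₀ lam (c i) x = 0 :=
  Finset.sum_eq_zero fun i _ => flatBump_eq_zero hlam (hx i)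

theorem support_sum_flatBump (hV₀ : 0 < V₀) (hlam : 0 < lam)
    (hd : ∀ i k, i ≠ k → Disjoint (Ioo (c i - flatRadius lam) (c i + flatRadius lam))
      (Ioo (c k - flatRadius lam) (c k + flatRadius lam))) :
    Function.support (fun x => ∑ i, flatBump V₀ lam (c i) x) =
      ⋃ i, Ioo (c i - flatRadius lam) (c i + flatRadius lam) := by
  ext x
  rw [mem_iUnion]
  constructor
  · intro h
    by_contra! hx
    exact h (sum_flatBump_of_notMem hlam hx)
  · rintro ⟨i, hi⟩
    rw [Function.mem_support, sum_flatBump_of_mem hlam hd hi]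
    exact ((isArc_flatBump hV₀ hlam (c i)).pos x hi).ne'

/-- The absorption is not linear, but at each point at most one of the disjoint bumps is nonzero. -/
theorem absorption_sum_flatBump (hlam : 0 < lam)
    (hd : ∀ i k, i ≠ k → Disjoint (Ioo (c i - flatRadius lam) (c i + flatRadius lam))
      (Ioo (c k - flatRadius lam) (c k + flatRadius lam))) (x : ℝ) :
    absorption V₀ (fun x => ∑ i, flatBump V₀ lam (c i) x) x =
      ∑ i, absorption V₀ (flatBump V₀ lam (c i)) x := by
  have hz : ∀ i, x ∉ Ioo (c i - flatRadius lam) (c i + flatRadius lam) →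
      absorption V₀ (flatBump V₀ lam (c i)) x = 0 := fun i hi => by
    rw [absorption, flatBump_eq_zero hlam hi, if_neg (lt_irrefl _)]
  by_cases hx : ∃ i, x ∈ Ioo (c i - flatRadius lam) (c i + flatRadius lam)
  · obtain ⟨i, hi⟩ := hx
    rw [Finset.sum_eq_single i (fun k _ hki => hz k
      fun h => Set.disjoint_left.1 (hd k i hki) h hi) (by simp)]
    simp only [absorption, sum_flatBump_of_mem hlam hd hi]
  · push Not at hx
    rw [Finset.sum_eq_zero fun i _ => hz i (hx i), absorption, sum_flatBump_of_notMem hlam hx,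
      if_neg (lt_irrefl _)]

theorem isNonnegSolution_of_mem_flatFamily {R : ℝ} (hV₀ : 0 < V₀) (hlam : 0 < lam)
    {u : ℝ → ℝ} (hu : u ∈ flatFamily V₀ R lam j) : IsNonnegSolution V₀ R lam u := by
  obtain ⟨c, hsub, hd, rfl⟩ := hu
  refine isNonnegSolution_of_hasDerivAt
    (U₁ := fun x => ∑ i, amplitude V₀ lam 1 * √lam * flatProfileDeriv (√lam * (x - c i)))
    (U₂ := fun x => ∑ i, amplitude V₀ lam 1 * √lam * √lam * flatProfileDeriv₂ (√lam * (x - c i)))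
    (S := ⋃ i, {c i - flatRadius lam, c i + flatRadius lam})
    (countable_iUnion fun i => Set.Finite.countable (by simp)) ?_ ?_ ?_ ?_ ?_ ?_ ?_ ?_ ?_
  · exact (continuous_finsetSum _ fun i _ => continuous_flatBump V₀ lam (c i)).continuousOn
  · exact fun x _ => Finset.sum_nonneg fun i _ => flatBump_nonneg hV₀ hlam _ _
  · exact sum_flatBump_of_notMem hlam fun i h => (hsub i h).1.false
  · exact sum_flatBump_of_notMem hlam fun i h => (hsub i h).2.false
  · exact fun x _ => HasDerivAt.fun_sum fun i _ => hasDerivAt_flatBump (c i) x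
  · have := continuous_flatProfileDeriv
    exact Continuous.continuousOn (by fun_prop)
  · intro x _ hx
    simp only [mem_iUnion, mem_insert_iff, mem_singleton_iff, not_exists, not_or] at hx
    exact HasDerivAt.fun_sum fun i _ => hasDerivAt_flatBump_deriv hlam (hx i).1 (hx i).2
  · intro a _ b _
    exact (integrable_finsetSum _ fun i _ =>
      integrable_flatBump_deriv₂ hlam (c i)).intervalIntegrable
  · intro x _ hx
    simp only [mem_iUnion, mem_insert_iff, mem_singleton_iff, not_exists, not_or] at hx
    rw [absorption_sum_flatBump hlam hd, Finset.mul_sum, ← Finset.sum_neg_distrib,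
      ← Finset.sum_add_distrib]
    refine Finset.sum_congr rfl fun i _ => ?_
    rw [flatBump_equation hV₀ hlam (hx i).1 (hx i).2]
    ring

theorem supNorm_of_mem_flatFamily {R : ℝ} (hV₀ : 0 < V₀) (hlam : 0 < lam) (hj : 1 ≤ j)
    {u : ℝ → ℝ} (hu : u ∈ flatFamily V₀ R lam j) :
    supNorm R u = ENNReal.ofReal (amplitude V₀ lam 1) := by
  have hsol := isNonnegSolution_of_mem_flatFamily hV₀ hlam hu
  obtain ⟨c, hsub, hd, rfl⟩ := hu
  have hr := flatRadius_pos hlam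
  refine supNorm_eq (hsol.continuousOn.mono Ioo_subset_Icc_self)
    (fun x hx => hsol.nonneg x (Ioo_subset_Icc_self hx)) (fun x _ => ?_) ?_
  · by_cases hx : ∃ i, x ∈ Ioo (c i - flatRadius lam) (c i + flatRadius lam)
    · obtain ⟨i, hi⟩ := hx
      rw [sum_flatBump_of_mem hlam hd hi]
      exact flatBump_le hV₀ hlam _ _
    · push Not at hx
      rw [sum_flatBump_of_notMem hlam hx]
      exact (amplitude_pos hV₀ hlam one_pos).le
  · have hi : c ⟨0, hj⟩ ∈ Ioo (c ⟨0, hj⟩ - flatRadius lam) (c ⟨0, hj⟩ + flatRadius lam) :=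
      ⟨by linarith, by linarith⟩
    exact ⟨_, hsub _ hi, by rw [sum_flatBump_of_mem hlam hd hi, flatBump_self]⟩

theorem hasCompactSupport_of_mem_flatFamily {R : ℝ} (hV₀ : 0 < V₀) (hlam : 0 < lam)
    {u : ℝ → ℝ} (hu : u ∈ flatFamily V₀ R lam j) : HasCompactSupport u := by
  obtain ⟨c, hsub, hd, rfl⟩ := hu
  refine HasCompactSupport.of_support_subset_isCompact (K := Icc (-R) R) isCompact_Icc ?_
  rw [support_sum_flatBump hV₀ hlam hd]
  exact iUnion_subset fun i => (hsub i).trans Ioo_subset_Icc_self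

theorem card_components_of_mem_flatFamily {R : ℝ} (hV₀ : 0 < V₀) (hlam : 0 < lam)
    {u : ℝ → ℝ} (hu : u ∈ flatFamily V₀ R lam j) :
    Nat.card (ConnectedComponents (Function.support u)) = j := by
  obtain ⟨c, hsub, hd, rfl⟩ := hu
  have hr := flatRadius_pos hlam
  exact card_connectedComponents_iUnion (support_sum_flatBump hV₀ hlam hd)
    (Or.inl fun i => isOpen_Ioo) (fun i => isConnected_Ioo (by linarith)) hd

/-- Compare measures: `j` disjoint intervals of length `2 * flatRadius lam` lie in an interval of
length `2R`. -/
theorem le_of_nonempty_flatFamily {R : ℝ} (hR : 0 < R) (hlam : 0 < lam)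
    (h : (flatFamily V₀ R lam j).Nonempty) : j * flatRadius lam ≤ R := by
  obtain ⟨_, c, hsub, hd, -⟩ := h
  have hr := flatRadius_pos hlam
  have h1 : volume (⋃ i, Ioo (c i - flatRadius lam) (c i + flatRadius lam)) ≤
      volume (Ioo (-R) R) := measure_mono (iUnion_subset hsub)
  rw [measure_iUnion (fun i k hik => hd i k hik) fun i => measurableSet_Ioo, tsum_fintype] at h1
  simp only [Real.volume_Ioo, add_sub_sub_cancel, Finset.sum_const, Finset.card_univ,
    Fintype.card_fin, nsmul_eq_mul] at h1
  rw [← ENNReal.ofReal_natCast, ← ENNReal.ofReal_mul (by positivity),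
    ENNReal.ofReal_le_ofReal_iff (by linarith)] at h1
  linarith

/-- The centres of `j` adjacent intervals of equal length that fill `(-R, R)`. -/
noncomputable def evenCentre (R : ℝ) (j : ℕ) (i : Fin j) : ℝ := -R + (2 * (i : ℝ) + 1) * (R / j)

theorem evenCentre_bounds {R : ℝ} (hR : 0 < R) (i : Fin j) :
    -R + R / j ≤ evenCentre R j i ∧ evenCentre R j i ≤ R - R / j := by
  have hj : (0 : ℝ) < j := by exact_mod_cast i.pos
  have hi : (i : ℝ) + 1 ≤ j := by exact_mod_cast i.2
  have hq : 0 < R / j := by positivity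
  have e : j * (R / j) = R := by field_simp
  have h0 : (0 : ℝ) ≤ (i : ℝ) := by positivity
  unfold evenCentre
  constructor <;> nlinarith

theorem evenCentre_add_le {R : ℝ} (hR : 0 < R) {i k : Fin j} (hik : i < k) :
    evenCentre R j i + 2 * (R / j) ≤ evenCentre R j k := by
  have hj : (0 : ℝ) < j := by exact_mod_cast i.pos
  have h : (i : ℝ) + 1 ≤ k := by exact_mod_cast hik
  have hq : 0 < R / j := by positivity
  unfold evenCentre
  nlinarith

theorem mem_flatFamily_even {R : ℝ} (hR : 0 < R) (h : j * flatRadius lam ≤ R) :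
    (fun x => ∑ i, flatBump V₀ lam (evenCentre R j i) x) ∈ flatFamily V₀ R lam j := by
  refine ⟨evenCentre R j, fun i => ?_, ?_, rfl⟩
  · have hj : (0 : ℝ) < j := by exact_mod_cast i.pos
    have h1 : flatRadius lam ≤ R / j := by rw [le_div_iff₀ hj]; linarith
    have := evenCentre_bounds hR i
    exact Ioo_subset_Ioo (by linarith) (by linarith)
  · have key : ∀ i k : Fin j, i < k →
        Disjoint (Ioo (evenCentre R j i - flatRadius lam) (evenCentre R j i + flatRadius lam))
          (Ioo (evenCentre R j k - flatRadius lam) (evenCentre R j k + flatRadius lam)) := by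
      intro i k hik
      have hj : (0 : ℝ) < j := by exact_mod_cast i.pos
      have h1 : flatRadius lam ≤ R / j := by rw [le_div_iff₀ hj]; linarith
      have h2 := evenCentre_add_le hR hik
      rw [Set.disjoint_left]
      intro x hx hx'
      linarith [hx.2, hx'.1]
    intro i k hik
    rcases lt_or_gt_of_ne hik with h | h
    · exact key i k h
    · exact (key k i h).symm

/-- Strict inequality makes each bump shorter than its slot of half-length `R / j`, so the closures
remain disjoint and stay away from `±R`. -/
theorem exists_mem_flatFamily_tsupport {R : ℝ} (hV₀ : 0 < V₀) (hlam : 0 < lam) (hR : 0 < R)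
    (h : j * flatRadius lam < R) : ∃ u ∈ flatFamily V₀ R lam j,
      tsupport u ⊆ Ioo (-R) R ∧ Nat.card (ConnectedComponents (tsupport u)) = j := by
  have hr := flatRadius_pos hlam
  have hmem := mem_flatFamily_even (V₀ := V₀) hR h.le
  refine ⟨_, hmem, ?_⟩
  have hd : ∀ i k : Fin j, i ≠ k →
      Disjoint (Icc (evenCentre R j i - flatRadius lam) (evenCentre R j i + flatRadius lam))
        (Icc (evenCentre R j k - flatRadius lam) (evenCentre R j k + flatRadius lam)) := by
    have key : ∀ i k : Fin j, i < k →
        Disjoint (Icc (evenCentre R j i - flatRadius lam) (evenCentre R j i + flatRadius lam))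
          (Icc (evenCentre R j k - flatRadius lam) (evenCentre R j k + flatRadius lam)) := by
      intro i k hik
      have hj : (0 : ℝ) < j := by exact_mod_cast i.pos
      have h1 : flatRadius lam < R / j := by rw [lt_div_iff₀ hj]; linarith
      have h2 := evenCentre_add_le hR hik
      rw [Set.disjoint_left]
      intro x hx hx'
      linarith [hx.2, hx'.1]
    intro i k hik
    rcases lt_or_gt_of_ne hik with h | h
    · exact key i k h
    · exact (key k i h).symm
  have ht : tsupport (fun x => ∑ i, flatBump V₀ lam (evenCentre R j i) x) =
      ⋃ i, Icc (evenCentre R j i - flatRadius lam) (evenCentre R j i + flatRadius lam) := by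
    rw [tsupport, support_sum_flatBump hV₀ hlam fun i k hik =>
      (hd i k hik).mono Ioo_subset_Icc_self Ioo_subset_Icc_self, closure_iUnion_of_finite]
    exact iUnion_congr fun i => closure_Ioo (by linarith)
  refine ⟨?_, ?_⟩
  · rw [ht]
    refine iUnion_subset fun i x hx => ?_
    have hj : (0 : ℝ) < j := by exact_mod_cast i.pos
    have h1 : flatRadius lam < R / j := by rw [lt_div_iff₀ hj]; linarith
    have := evenCentre_bounds hR i
    exact ⟨by linarith [hx.1], by linarith [hx.2]⟩
  · exact card_connectedComponents_iUnion ht (Or.inr fun i => isClosed_Icc)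
      (fun i => isConnected_Icc (by linarith)) hd

theorem nonempty_flatFamily_iff {R : ℝ} (hR : 0 < R) (hlam : 0 < lam) :
    (flatFamily V₀ R lam j).Nonempty ↔ j * flatRadius lam ≤ R :=
  ⟨le_of_nonempty_flatFamily hR hlam, fun h => ⟨_, mem_flatFamily_even hR h⟩⟩

end FlatBump

/-! ### Classification of the nontrivial solutions -/

theorem IsNonnegSolution.exists_flatBump {V₀ R lam x : ℝ} {U : ℝ → ℝ} (hV₀ : 0 < V₀)
    (hlamR : flatRadius lam < R) (hU : IsNonnegSolution V₀ R lam U) (hx : x ∈ Icc (-R) R)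
    (hpos : 0 < U x) : ∃ c, -R ≤ c - flatRadius lam ∧ c + flatRadius lam ≤ R ∧
      x ∈ Ioo (c - flatRadius lam) (c + flatRadius lam) ∧
      U (c + flatRadius lam) = 0 ∧
      EqOn U (flatBump V₀ lam c) (Icc (c - flatRadius lam) (c + flatRadius lam)) := by
  obtain ⟨hlam, k, hk, c, h1, h2, h3, -, h4, h5, h6⟩ := hU.exists_model hV₀ hx hpos
  have hk1 : k = 1 := by
    rcases h6 with h6 | ⟨-, h6⟩
    · exact h6
    -- An arc filling the interval is excluded: flat arcs are the longest, and they are already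
    -- shorter than the interval.
    · have h7 : halfPeriod k ≤ halfPeriod 1 :=
        strictMonoOn_halfPeriod.monotoneOn hk.2 (mem_Iic.2 le_rfl) hk.2
      have h8 : halfPeriod k / √lam ≤ flatRadius lam :=
        div_le_div_of_nonneg_right h7 (Real.sqrt_nonneg _)
      linarith
  subst hk1
  exact ⟨c, h1, h2, h3, h4, h5 _ _ isProfile_flat⟩

theorem IsNonnegSolution.exists_mem_flatFamily {V₀ R lam : ℝ} {U : ℝ → ℝ} (hV₀ : 0 < V₀)
    (hR : 0 < R) (hlam : 0 < lam) (hlamR : flatRadius lam < R) (hU : IsNonnegSolution V₀ R lam U)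
    (hnt : Nontrivial R U) :
    ∃ j, 1 ≤ j ∧ ∃ u ∈ flatFamily V₀ R lam j, EqOn U u (Icc (-R) R) := by
  have hr := flatRadius_pos hlam
  -- The centres of all flat arcs of `U`. The zero of `U` at the right end is recorded because it is
  -- what prevents overlaps.
  set C : Set ℝ := {c | -R ≤ c - flatRadius lam ∧ c + flatRadius lam ≤ R ∧
    U (c + flatRadius lam) = 0 ∧
    EqOn U (flatBump V₀ lam c) (Icc (c - flatRadius lam) (c + flatRadius lam))} with hC
  -- If two arcs overlapped, the right end of the first would be a zero of `U` inside the second,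
  -- where `U` is positive.
  have hsep : ∀ c ∈ C, ∀ c' ∈ C, c < c' → c + flatRadius lam ≤ c' - flatRadius lam := by
    intro c hc c' hc' hlt
    by_contra! hn
    have hm : c + flatRadius lam ∈ Ioo (c' - flatRadius lam) (c' + flatRadius lam) :=
      ⟨hn, by linarith⟩
    have h1 := hc'.2.2.2 (Ioo_subset_Icc_self hm)
    rw [hc.2.2.1] at h1
    exact ((isArc_flatBump hV₀ hlam c').pos _ hm).ne h1
  have hdisj : ∀ c ∈ C, ∀ c' ∈ C, c ≠ c' →
      Disjoint (Ioo (c - flatRadius lam) (c + flatRadius lam))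
        (Ioo (c' - flatRadius lam) (c' + flatRadius lam)) := by
    intro c hc c' hc' hne
    rw [Set.disjoint_left]
    intro x hx hx'
    rcases lt_or_gt_of_ne hne with h | h
    · linarith [hsep c hc c' hc' h, hx.2, hx'.1]
    · linarith [hsep c' hc' c hc h, hx.1, hx'.2]
  have hfam : ∀ t : Finset ℝ, (t : Set ℝ) ⊆ C →
      (fun x => ∑ i, flatBump V₀ lam (t.equivFin.symm i : ℝ) x) ∈ flatFamily V₀ R lam t.card := by
    intro t ht
    have hm : ∀ i, (t.equivFin.symm i : ℝ) ∈ C := fun i => ht (t.equivFin.symm i).2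
    refine ⟨fun i => (t.equivFin.symm i : ℝ), fun i => Ioo_subset_Ioo (hm i).1 (hm i).2.1,
      fun i k hik => hdisj _ (hm i) _ (hm k) fun h => hik ?_, rfl⟩
    exact t.equivFin.symm.injective (Subtype.ext h)
  -- Any finite set of centres gives a member of the family, so the measure bound limits its
  -- cardinality.
  have hfin : C.Finite := by
    by_contra hinf
    obtain ⟨N, hN⟩ := exists_nat_gt (R / flatRadius lam)
    obtain ⟨t, ht, hcard⟩ := Set.Infinite.exists_subset_card_eq hinf N
    have := le_of_nonempty_flatFamily hR hlam ⟨_, hfam t ht⟩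
    rw [hcard] at this
    rw [div_lt_iff₀ hr] at hN
    linarith
  have hsub : (hfin.toFinset : Set ℝ) ⊆ C := by simp
  refine ⟨hfin.toFinset.card, ?_, _, hfam _ hsub, ?_⟩
  · obtain ⟨x, hx, hx0⟩ := hnt
    have hx' := Ioo_subset_Icc_self hx
    obtain ⟨c, h1, h2, -, h3, h4⟩ := hU.exists_flatBump hV₀ hlamR hx'
      (lt_of_le_of_ne (hU.nonneg x hx') hx0.symm)
    exact Finset.card_pos.2 ⟨c, hfin.mem_toFinset.2 ⟨h1, h2, h3, h4⟩⟩
  · intro x hx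
    have hm : ∀ i, (hfin.toFinset.equivFin.symm i : ℝ) ∈ C := fun i =>
      hsub (hfin.toFinset.equivFin.symm i).2
    have hd' : ∀ i k : Fin hfin.toFinset.card, i ≠ k →
        Disjoint (Ioo ((hfin.toFinset.equivFin.symm i : ℝ) - flatRadius lam)
          ((hfin.toFinset.equivFin.symm i : ℝ) + flatRadius lam))
        (Ioo ((hfin.toFinset.equivFin.symm k : ℝ) - flatRadius lam)
          ((hfin.toFinset.equivFin.symm k : ℝ) + flatRadius lam)) := fun i k hik =>
      hdisj _ (hm i) _ (hm k) fun h =>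
        hik (hfin.toFinset.equivFin.symm.injective (Subtype.ext h))
    by_cases hxi : ∃ i, x ∈ Ioo ((hfin.toFinset.equivFin.symm i : ℝ) - flatRadius lam)
          ((hfin.toFinset.equivFin.symm i : ℝ) + flatRadius lam)
    · obtain ⟨i, hi⟩ := hxi
      simp only
      rw [sum_flatBump_of_mem hlam (c := fun i => (hfin.toFinset.equivFin.symm i : ℝ)) hd' hi]
      exact (hm i).2.2.2 (Ioo_subset_Icc_self hi)
    · push Not at hxi
      simp only
      rw [sum_flatBump_of_notMem hlam (c := fun i => (hfin.toFinset.equivFin.symm i : ℝ)) hxi]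
      by_contra hne
      obtain ⟨c, h1, h2, h5, h3, h4⟩ := hU.exists_flatBump hV₀ hlamR hx
        (lt_of_le_of_ne (hU.nonneg x hx) (Ne.symm hne))
      have hcm : c ∈ hfin.toFinset := hfin.mem_toFinset.2 ⟨h1, h2, h3, h4⟩
      refine hxi (hfin.toFinset.equivFin ⟨c, hcm⟩) ?_
      simpa using h5

theorem IsNonnegSolution.eqOn_model {V₀ R lam k : ℝ} {V s s₁ : ℝ → ℝ} (hV₀ : 0 < V₀)
    (hk : k ∈ Ioc (0 : ℝ) 1) (hT : halfPeriod k / √lam = R) (hs : IsProfile k (halfPeriod k) s s₁)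
    (hV : IsNonnegSolution V₀ R lam V) (hnt : Nontrivial R V) :
    EqOn V (fun y => amplitude V₀ lam k * s (√lam * (y - 0))) (Icc (-R) R) := by
  obtain ⟨x, hx, hx0⟩ := hnt
  have hx' := Ioo_subset_Icc_self hx
  obtain ⟨hlam, l, hl, c, h1, h2, -, -, -, h3, h4⟩ := hV.exists_model hV₀ hx'
    (lt_of_le_of_ne (hV.nonneg x hx') hx0.symm)
  have h5 : c = 0 ∧ halfPeriod l / √lam = R := by
    -- A flat arc is at least as long as the one with parameter `k`, whose half-length is `R`; since
    -- it fits, it also fills the interval.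
    rcases h4 with rfl | h4
    · have h7 : halfPeriod k ≤ halfPeriod 1 :=
        strictMonoOn_halfPeriod.monotoneOn hk.2 (mem_Iic.2 le_rfl) hk.2
      have h8 : halfPeriod k / √lam ≤ halfPeriod 1 / √lam :=
        div_le_div_of_nonneg_right h7 (Real.sqrt_nonneg _)
      constructor <;> linarith
    · exact h4
  obtain ⟨rfl, h5⟩ := h5
  have hr := Real.sqrt_pos.2 hlam
  have h6 : halfPeriod l = halfPeriod k := by
    rw [← hT] at h5
    exact (div_left_inj' hr.ne').1 h5
  obtain rfl : l = k := strictMonoOn_halfPeriod.injOn hl.2 hk.2 h6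
  have := h3 s s₁ hs
  rwa [hT, zero_sub, zero_add] at this

theorem exists_unique_positive {V₀ R lam k : ℝ} (hV₀ : 0 < V₀) (hR : 0 < R) (hlam : 0 < lam)
    (hk : k ∈ Ioc (0 : ℝ) 1) (hT : halfPeriod k / √lam = R) :
    ∃ U, IsPositiveSolution V₀ R lam U ∧
      (∀ V, IsNonnegSolution V₀ R lam V → Nontrivial R V → EqOn V U (Icc (-R) R)) ∧
      HasDerivWithinAt U (amplitude V₀ lam k * √lam * -√(1 - k)) (Icc (-R) R) R ∧
      HasDerivWithinAt U (amplitude V₀ lam k * √lam * √(1 - k)) (Icc (-R) R) (-R) ∧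
      supNorm R U = ENNReal.ofReal (amplitude V₀ lam k) := by
  obtain ⟨s, s₁, hs⟩ := exists_isProfile hk.1 hk.2
  have hA := amplitude_pos hV₀ hlam hk.1
  have hr := Real.sqrt_pos.2 hlam
  have harc := hs.isArc hlam hA (amplitude_mul_sqrt hV₀ hlam hk.1) 0
  rw [hT, zero_sub, zero_add] at harc
  have er : √lam * R = halfPeriod k := by rw [← hT]; field_simp
  have hT0 := hs.period_pos
  have hU := harc.isPositiveSolution
  refine ⟨_, hU, fun V hV hnt => hV.eqOn_model hV₀ hk hT hs hnt, ?_, ?_, ?_⟩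
  · have h3 : √lam * (R - 0) = halfPeriod k := by rw [sub_zero, er]
    have h4 := hasDerivAt_scaled (r := √lam) (c := 0) (x := R)
      (amplitude V₀ lam k) (by rw [h3]; exact hs.hasDerivAt _ (right_mem_Icc.2 (by linarith)))
    rw [hs.deriv_right] at h4
    exact h4.hasDerivWithinAt
  · have h3 : √lam * (-R - 0) = -halfPeriod k := by rw [sub_zero, mul_neg, er]
    have h4 := hasDerivAt_scaled (r := √lam) (c := 0) (x := -R)
      (amplitude V₀ lam k) (by rw [h3]; exact hs.hasDerivAt _ (left_mem_Icc.2 (by linarith)))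
    rw [hs.deriv_left] at h4
    exact h4.hasDerivWithinAt
  · refine supNorm_eq (hU.1.continuousOn.mono Ioo_subset_Icc_self) (fun x hx => (hU.2 x hx).le)
      (fun x hx => ?_) ⟨0, ⟨by linarith, hR⟩, by simp [hs.apply_zero]⟩
    refine mul_le_of_le_one_right hA.le (hs.le_one _ ?_)
    exact mul_sub_mem_Ioo hr (by rwa [hT, zero_sub, zero_add])

/-! ### Inverse of `γ` and the thresholds for `λ` -/

/-- The witness inverts `k = 4/μ^(3/2)`, and `k ≤ 1` corresponds to `rF ≤ μ`. Uniqueness is the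
injectivity of `halfPeriod`. -/
theorem exists_unique_gamma_eq {k : ℝ} (hk : k ∈ Ioc (0 : ℝ) 1) :
    rF ≤ (4 / k) ^ (2 / 3 : ℝ) ∧ gamma ((4 / k) ^ (2 / 3 : ℝ)) = halfPeriod k ∧
      ∀ μ, rF ≤ μ → gamma μ = halfPeriod k → μ = (4 / k) ^ (2 / 3 : ℝ) := by
  have hk0 := hk.1
  have e := rpow_two_thirds_mul_sqrt (q := 4 / k) (by positivity)
  have h1 : rF ≤ (4 / k) ^ (2 / 3 : ℝ) := by
    have h4 : (4 : ℝ) ≤ 4 / k := by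
      rw [le_div_iff₀ hk0]
      linarith [hk.2]
    calc rF = (rF * √rF) ^ (2 / 3 : ℝ) := (rpow_two_thirds_of_mul_sqrt rF_pos.le).symm
      _ ≤ _ := by
        rw [rF_mul_sqrt]
        gcongr
  refine ⟨h1, ?_, fun μ hμ h => ?_⟩
  · rw [gamma_eq_halfPeriod h1, e, div_div_cancel₀ (by norm_num)]
  · have h4 := four_le_mul_sqrt hμ
    rw [gamma_eq_halfPeriod hμ] at h
    have h5 : 4 / (μ * √μ) ≤ 1 := by rw [div_le_one (by linarith)]; exact h4
    have h6 := strictMonoOn_halfPeriod.injOn h5 hk.2 h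
    rw [← h6, div_div_cancel₀ (by norm_num), rpow_two_thirds_of_mul_sqrt (rF_pos.le.trans hμ)]

theorem sqrt_lamStar {R : ℝ} (hR : 0 < R) : √(lamStar R) = halfPeriod 1 / R := by
  rw [lamStar_eq hR, Real.sqrt_sq (by positivity), halfPeriod_one]

theorem lamStar_pos {R : ℝ} (hR : 0 < R) : 0 < lamStar R := by
  rw [lamStar_eq hR]
  positivity

theorem flatRadius_lamStar {R : ℝ} (hR : 0 < R) : flatRadius (lamStar R) = R := by
  have := isProfile_flat.period_pos
  rw [flatRadius, sqrt_lamStar hR, div_div_cancel₀ this.ne']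

theorem pi_div_lt_lamStar {R : ℝ} (hR : 0 < R) : (Real.pi / (2 * R)) ^ 2 < lamStar R := by
  rw [lamStar_eq hR, div_div]
  have := Real.pi_pos
  refine pow_lt_pow_left₀ ?_ (by positivity) two_ne_zero
  rw [div_lt_div_iff₀ (by positivity) (by positivity)]
  nlinarith [mul_pos this hR]

/-- A nontrivial solution contains an arc, whose half-length `halfPeriod k / √λ` exceeds `π/(2√λ)`
and is at most `R`. -/
theorem not_exists_of_lt {V₀ R lam : ℝ} (hV₀ : 0 < V₀) (hR : 0 < R)
    (h : lam < (Real.pi / (2 * R)) ^ 2) :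
    ¬ ∃ U : ℝ → ℝ, IsNonnegSolution V₀ R lam U ∧ Nontrivial R U := by
  rintro ⟨U, hU, x, hx, hx0⟩
  have hx' := Ioo_subset_Icc_self hx
  obtain ⟨hlam, k, hk, c, h1, h2, -⟩ := hU.exists_model hV₀ hx'
    (lt_of_le_of_ne (hU.nonneg x hx') hx0.symm)
  have hr := Real.sqrt_pos.2 hlam
  have h3 : halfPeriod k / √lam ≤ R := by linarith
  rw [div_le_iff₀ hr] at h3
  have h4 := halfPeriod_gt hk.1 hk.2
  have h5 : √lam < Real.pi / (2 * R) := by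
    rw [← Real.sqrt_sq (by positivity : (0 : ℝ) ≤ Real.pi / (2 * R))]
    exact Real.sqrt_lt_sqrt hlam.le h
  rw [lt_div_iff₀ (by positivity)] at h5
  linarith

theorem exists_halfPeriod_div_eq {R lam : ℝ} (hR : 0 < R) (h1 : (Real.pi / (2 * R)) ^ 2 < lam)
    (h2 : lam < lamStar R) : 0 < lam ∧ ∃ k ∈ Ioo (0 : ℝ) 1, halfPeriod k = √lam * R := by
  have hlam : 0 < lam := (by positivity : (0 : ℝ) ≤ (Real.pi / (2 * R)) ^ 2).trans_lt h1
  refine ⟨hlam, exists_halfPeriod_eq ?_ ?_⟩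
  · have := Real.lt_sqrt_of_sq_lt h1
    rw [div_lt_iff₀ (by positivity)] at this
    linarith
  · have := Real.sqrt_lt_sqrt hlam.le h2
    rwa [sqrt_lamStar hR, lt_div_iff₀ hR, halfPeriod_one] at this

/-! ### Scaling of the critical solution -/

section Critical

variable {V₀ R lam ω : ℝ} {W : ℝ → ℝ}

theorem indicator_eq_flatBump (hV₀ : 0 < V₀) (hR : 0 < R)
    (hW : IsPositiveSolution V₀ R (lamStar R) W) :
    (Ioo (-R) R).indicator W = flatBump V₀ (lamStar R) 0 := by
  have hnt : Nontrivial R W := ⟨0, ⟨by linarith, hR⟩, (hW.2 0 ⟨by linarith, hR⟩).ne'⟩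
  have e := hW.1.eqOn_model hV₀ ⟨one_pos, le_rfl⟩ (flatRadius_lamStar hR) isProfile_flat hnt
  funext x
  by_cases hx : x ∈ Ioo (-R) R
  · rw [indicator_of_mem hx]
    exact e (Ioo_subset_Icc_self hx)
  · rw [indicator_of_notMem hx, flatBump_eq_zero (lamStar_pos hR)]
    rwa [flatRadius_lamStar hR, zero_sub, zero_add]

theorem supNorm_critical (hV₀ : 0 < V₀) (hR : 0 < R)
    (hW : IsPositiveSolution V₀ R (lamStar R) W) :
    supNorm R W = ENNReal.ofReal (amplitude V₀ (lamStar R) 1) := by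
  have e : ∀ x ∈ Ioo (-R) R, W x = flatBump V₀ (lamStar R) 0 x := fun x hx => by
    rw [← indicator_eq_flatBump hV₀ hR hW, indicator_of_mem hx]
  have h0 : (0 : ℝ) ∈ Ioo (-R) R := ⟨by linarith, hR⟩
  refine supNorm_eq (hW.1.continuousOn.mono Ioo_subset_Icc_self) (fun x hx => (hW.2 x hx).le)
    (fun x hx => ?_) ⟨0, h0, by rw [e 0 h0, flatBump_self]⟩
  rw [e x hx]
  exact flatBump_le hV₀ (lamStar_pos hR) _ _

theorem amplitude_mul (hV₀ : 0 < V₀) (hR : 0 < R) (hω : 0 < ω) :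
    amplitude V₀ (lamStar R * ω) 1 = 1 / ω ^ (2 / 3 : ℝ) * amplitude V₀ (lamStar R) 1 := by
  have := lamStar_pos hR
  rw [amplitude, amplitude, mul_one, mul_one, ← div_div, Real.div_rpow (by positivity) hω.le]
  ring

theorem bump_eq_flatBump (hV₀ : 0 < V₀) (hR : 0 < R) (hω : 0 < ω)
    (hW : IsPositiveSolution V₀ R (lamStar R) W) (z : ℝ) :
    bump R W ω z = flatBump V₀ (lamStar R * ω) (z / √ω) := by
  have hs := Real.sqrt_pos.2 hω
  funext x
  rw [bump, indicator_eq_flatBump hV₀ hR hW, flatBump, flatBump, amplitude_mul hV₀ hR hω,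
    Real.sqrt_mul (lamStar_pos hR).le, mul_assoc]
  congr 3
  field_simp
  ring

theorem flatRadius_mul (hR : 0 < R) (ω : ℝ) : flatRadius (lamStar R * ω) = R / √ω := by
  rw [flatRadius, Real.sqrt_mul (lamStar_pos hR).le, ← div_div]
  exact congrArg (· / √ω) (flatRadius_lamStar hR)

/-- The shift `z` corresponds to the centre `z / √ω`. All statements about bumps are thereby reduced
to flat bumps at `λ = lamStar R * ω`, of radius `R / √ω`. -/
theorem bumpFamily_eq_flatFamily (hV₀ : 0 < V₀) (hR : 0 < R) (hω : 0 < ω)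
    (hW : IsPositiveSolution V₀ R (lamStar R) W) (j : ℕ) :
    bumpFamily R W ω j = flatFamily V₀ R (lamStar R * ω) j := by
  have hs := Real.sqrt_pos.2 hω
  have hlam : 0 < lamStar R * ω := mul_pos (lamStar_pos hR) hω
  ext u
  simp only [bumpFamily, flatFamily, bump_eq_flatBump hV₀ hR hω hW, support_flatBump hV₀ hlam,
    mem_ofPred_eq]
  constructor
  · rintro ⟨z, h1, h2, h3⟩
    exact ⟨fun i => z i / √ω, h1, h2, h3⟩
  · rintro ⟨c, h1, h2, h3⟩
    refine ⟨fun i => c i * √ω, ?_⟩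
    simp only [mul_div_cancel_right₀ _ hs.ne']
    exact ⟨h1, h2, h3⟩

theorem support_bump (hV₀ : 0 < V₀) (hR : 0 < R) (hω : 0 < ω)
    (hW : IsPositiveSolution V₀ R (lamStar R) W) (z : ℝ) :
    Function.support (bump R W ω z) = Ioo ((z - R) / √ω) ((z + R) / √ω) := by
  rw [bump_eq_flatBump hV₀ hR hω hW, support_flatBump hV₀ (mul_pos (lamStar_pos hR) hω),
    flatRadius_mul hR, sub_div, add_div]

theorem support_bump_subset_iff (hV₀ : 0 < V₀) (hR : 0 < R) (hω : 0 < ω)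
    (hW : IsPositiveSolution V₀ R (lamStar R) W) (z : ℝ) :
    Function.support (bump R W ω z) ⊆ Ioo (-R) R ↔ |z| ≤ (√ω - 1) * R := by
  have hs := Real.sqrt_pos.2 hω
  rw [support_bump hV₀ hR hω hW, Ioo_subset_Ioo_iff (by gcongr; linarith), le_div_iff₀ hs,
    div_le_iff₀ hs, abs_le]
  constructor
  · rintro ⟨h1, h2⟩
    constructor <;> linarith
  · rintro ⟨h1, h2⟩
    constructor <;> linarith

theorem mul_div_sqrt_le_iff (hR : 0 < R) (hω : 0 < ω) (j : ℕ) :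
    j * flatRadius (lamStar R * ω) ≤ R ↔ (j : ℝ) ≤ √ω := by
  have hs := Real.sqrt_pos.2 hω
  rw [flatRadius_mul hR, ← mul_div_assoc, div_le_iff₀ hs, mul_comm R, mul_le_mul_iff_left₀ hR]

theorem mul_div_sqrt_lt_iff (hR : 0 < R) (hω : 0 < ω) (j : ℕ) :
    j * flatRadius (lamStar R * ω) < R ↔ (j : ℝ) < √ω := by
  have hs := Real.sqrt_pos.2 hω
  rw [flatRadius_mul hR, ← mul_div_assoc, div_lt_iff₀ hs, mul_comm R, mul_lt_mul_iff_left₀ hR]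

theorem bumpFamily_nonempty_iff (hV₀ : 0 < V₀) (hR : 0 < R) (hω : 0 < ω)
    (hW : IsPositiveSolution V₀ R (lamStar R) W) (j : ℕ) :
    (bumpFamily R W ω j).Nonempty ↔ j ≤ ⌊√ω⌋₊ := by
  rw [bumpFamily_eq_flatFamily hV₀ hR hω hW,
    nonempty_flatFamily_iff hR (mul_pos (lamStar_pos hR) hω), mul_div_sqrt_le_iff hR hω,
    Nat.le_floor_iff (Real.sqrt_nonneg _)]

theorem isNonnegSolution_bump (hV₀ : 0 < V₀) (hR : 0 < R) (hω : 0 < ω)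
    (hW : IsPositiveSolution V₀ R (lamStar R) W) {z : ℝ} (hz : |z| ≤ (√ω - 1) * R) :
    IsNonnegSolution V₀ R (lamStar R * ω) (bump R W ω z) := by
  have hmem : bump R W ω z ∈ bumpFamily R W ω 1 :=
    ⟨fun _ => z, fun _ => (support_bump_subset_iff hV₀ hR hω hW z).2 hz,
      fun i k hik => absurd (Subsingleton.elim i k) hik, by simp⟩
  rw [bumpFamily_eq_flatFamily hV₀ hR hω hW] at hmem
  exact isNonnegSolution_of_mem_flatFamily hV₀ (mul_pos (lamStar_pos hR) hω) hmem

theorem nontrivial_of_mem_flatFamily {j : ℕ} {u : ℝ → ℝ} (hV₀ : 0 < V₀) (hlam : 0 < lam)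
    (hj : 1 ≤ j) (hu : u ∈ flatFamily V₀ R lam j) : Nontrivial R u := by
  obtain ⟨c, hsub, hd, rfl⟩ := hu
  have hr := flatRadius_pos hlam
  have hi : c ⟨0, hj⟩ ∈ Ioo (c ⟨0, hj⟩ - flatRadius lam) (c ⟨0, hj⟩ + flatRadius lam) :=
    ⟨by linarith, by linarith⟩
  refine ⟨_, hsub _ hi, ?_⟩
  beta_reduce
  rw [sum_flatBump_of_mem hlam hd hi, flatBump_self]
  exact (amplitude_pos hV₀ hlam one_pos).ne'

theorem isNonnegSolution_nontrivial_iff (hV₀ : 0 < V₀) (hR : 0 < R) (hω : 1 < ω)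
    (hW : IsPositiveSolution V₀ R (lamStar R) W) (U : ℝ → ℝ) :
    (IsNonnegSolution V₀ R (lamStar R * ω) U ∧ Nontrivial R U) ↔
      ∃ j ∈ Finset.Icc 1 ⌊√ω⌋₊, ∃ u ∈ bumpFamily R W ω j, EqOn U u (Icc (-R) R) := by
  have hω0 : 0 < ω := one_pos.trans hω
  have hlam : 0 < lamStar R * ω := mul_pos (lamStar_pos hR) hω0
  constructor
  · rintro ⟨hU, hnt⟩
    have hlt : flatRadius (lamStar R * ω) < R := by
      have : (1 : ℝ) < √ω := Real.lt_sqrt_of_sq_lt (by simpa using hω)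
      simpa using (mul_div_sqrt_lt_iff hR hω0 1).2 (by simpa using this)
    obtain ⟨j, hj, u, hu, e⟩ := hU.exists_mem_flatFamily hV₀ hR hlam hlt hnt
    rw [← bumpFamily_eq_flatFamily hV₀ hR hω0 hW] at hu
    exact ⟨j, Finset.mem_Icc.2 ⟨hj, (bumpFamily_nonempty_iff hV₀ hR hω0 hW j).1 ⟨u, hu⟩⟩, u, hu, e⟩
  · rintro ⟨j, hj, u, hu, e⟩
    rw [bumpFamily_eq_flatFamily hV₀ hR hω0 hW] at hu
    refine ⟨(isNonnegSolution_of_mem_flatFamily hV₀ hlam hu).congr hR e, ?_⟩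
    obtain ⟨x, hx, hx0⟩ := nontrivial_of_mem_flatFamily hV₀ hlam (Finset.mem_Icc.1 hj).1 hu
    exact ⟨x, hx, by rwa [e (Ioo_subset_Icc_self hx)]⟩

end Critical

end SingularEigenvalue

/-! ### Assembly of the theorem -/

theorem theorem34 (V₀ R : ℝ) (hV₀ : 0 < V₀) (hR : 0 < R) :
    -- the integrals that define `γ` and `λ₁*` converge, and the interval in b) is non-empty
    (∀ μ, SingularEigenvalue.rF ≤ μ →
      IntervalIntegrable
        (fun r => 1 / √(SingularEigenvalue.F μ - SingularEigenvalue.F r)) volume 0 μ) ∧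
    (Real.pi / (2 * R)) ^ 2 < SingularEigenvalue.lamStar R ∧
    -- a)
    (∀ lam : ℝ, lam < (Real.pi / (2 * R)) ^ 2 →
      ¬ ∃ U : ℝ → ℝ, SingularEigenvalue.IsNonnegSolution V₀ R lam U ∧
        SingularEigenvalue.Nontrivial R U) ∧
    -- b)
    (∀ lam : ℝ, (Real.pi / (2 * R)) ^ 2 < lam → lam < SingularEigenvalue.lamStar R →
      ∃ U : ℝ → ℝ, SingularEigenvalue.IsPositiveSolution V₀ R lam U ∧
        (∀ V : ℝ → ℝ, SingularEigenvalue.IsNonnegSolution V₀ R lam V →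
          SingularEigenvalue.Nontrivial R V → EqOn V U (Icc (-R) R)) ∧
        (∃ d, HasDerivWithinAt U d (Icc (-R) R) R ∧ d < 0) ∧
        (∃ d, HasDerivWithinAt U d (Icc (-R) R) (-R) ∧ -d < 0) ∧
        (∃ μ, SingularEigenvalue.rF ≤ μ ∧ SingularEigenvalue.gamma μ = √lam * R ∧
          (∀ μ', SingularEigenvalue.rF ≤ μ' → SingularEigenvalue.gamma μ' = √lam * R → μ' = μ) ∧
          SingularEigenvalue.supNorm R U = ENNReal.ofReal ((V₀ / lam) ^ (2 / 3 : ℝ) * μ))) ∧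
    -- c)
    (∃ W : ℝ → ℝ,
      SingularEigenvalue.IsPositiveSolution V₀ R (SingularEigenvalue.lamStar R) W ∧
      (∀ V : ℝ → ℝ, SingularEigenvalue.IsNonnegSolution V₀ R (SingularEigenvalue.lamStar R) V →
        SingularEigenvalue.Nontrivial R V → EqOn V W (Icc (-R) R)) ∧
      HasDerivWithinAt W 0 (Icc (-R) R) R ∧
      HasDerivWithinAt W 0 (Icc (-R) R) (-R) ∧
      SingularEigenvalue.supNorm R W =
        ENNReal.ofReal ((4 * V₀ / SingularEigenvalue.lamStar R) ^ (2 / 3 : ℝ))) ∧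
    -- d)
    (∀ W : ℝ → ℝ,
      SingularEigenvalue.IsPositiveSolution V₀ R (SingularEigenvalue.lamStar R) W →
      ∀ lam ω : ℝ, SingularEigenvalue.lamStar R < lam →
      lam = SingularEigenvalue.lamStar R * ω →
        -- single bumps: admissible shifts, and the solutions that they give
        (∀ z : ℝ, Function.support (SingularEigenvalue.bump R W ω z) ⊆ Ioo (-R) R ↔
          |z| ≤ (√ω - 1) * R) ∧
        (∀ z : ℝ, |z| ≤ (√ω - 1) * R →
          SingularEigenvalue.IsNonnegSolution V₀ R lam (SingularEigenvalue.bump R W ω z) ∧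
          Function.support (SingularEigenvalue.bump R W ω z) =
            Ioo ((z - R) / √ω) ((z + R) / √ω) ∧
          tsupport (SingularEigenvalue.bump R W ω z) =
            Icc ((z - R) / √ω) ((z + R) / √ω)) ∧
        -- sums of `j` bumps: solutions with `j` components, for `1 ≤ j ≤ N(λ) = ⌊√ω⌋`
        (∀ j : ℕ, 1 ≤ j →
          ((SingularEigenvalue.bumpFamily R W ω j).Nonempty ↔ j ≤ ⌊√ω⌋₊)) ∧
        (∀ j : ℕ, 1 ≤ j → ∀ u ∈ SingularEigenvalue.bumpFamily R W ω j,
          SingularEigenvalue.IsNonnegSolution V₀ R lam u ∧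
          HasCompactSupport u ∧
          Nat.card (ConnectedComponents (Function.support u)) = j ∧
          SingularEigenvalue.supNorm R u =
            ENNReal.ofReal (1 / ω ^ (2 / 3 : ℝ)) * SingularEigenvalue.supNorm R W ∧
          SingularEigenvalue.supNorm R u =
            ENNReal.ofReal (1 / ω ^ (2 / 3 : ℝ) *
              (4 * V₀ / SingularEigenvalue.lamStar R) ^ (2 / 3 : ℝ))) ∧
        -- if `j < √ω`, some of them have a closed support inside `(-R, R)` with `j` components
        (∀ j : ℕ, 1 ≤ j → (j : ℝ) < √ω →
          ∃ u ∈ SingularEigenvalue.bumpFamily R W ω j,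
            tsupport u ⊆ Ioo (-R) R ∧
            Nat.card (ConnectedComponents (tsupport u)) = j) ∧
        -- there are no other nontrivial nonnegative solutions
        (∀ U : ℝ → ℝ,
          (SingularEigenvalue.IsNonnegSolution V₀ R lam U ∧
            SingularEigenvalue.Nontrivial R U) ↔
          ∃ j ∈ Finset.Icc 1 ⌊√ω⌋₊, ∃ u ∈ SingularEigenvalue.bumpFamily R W ω j,
            EqOn U u (Icc (-R) R))) := by
  open SingularEigenvalue in
  refine ⟨fun μ hμ => intervalIntegrable_gamma hμ, pi_div_lt_lamStar hR,
    fun lam h => not_exists_of_lt hV₀ hR h, fun lam h1 h2 => ?_, ?_,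
    fun W hW lam ω hlt hlamω => ?_⟩
  · obtain ⟨hlam, k, hk, hT⟩ := exists_halfPeriod_div_eq hR h1 h2
    have hr := Real.sqrt_pos.2 hlam
    have hA := amplitude_pos hV₀ hlam hk.1
    have hk' : k ∈ Ioc (0 : ℝ) 1 := Ioo_subset_Ioc_self hk
    obtain ⟨U, hU, huniq, hd1, hd2, hnorm⟩ := exists_unique_positive hV₀ hR hlam hk'
      (by rw [hT]; field_simp)
    obtain ⟨hμ1, hμ2, hμ3⟩ := exists_unique_gamma_eq hk'
    -- Below the critical value `k < 1` strictly, so the boundary slopes do not vanish.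
    have hq : 0 < amplitude V₀ lam k * √lam * √(1 - k) :=
      mul_pos (mul_pos hA hr) (Real.sqrt_pos.2 (by linarith [hk.2]))
    rw [hT] at hμ2 hμ3
    refine ⟨U, hU, huniq, ⟨_, hd1, by linarith⟩, ⟨_, hd2, by linarith⟩, _, hμ1, hμ2, hμ3, ?_⟩
    have hk0 := hk.1
    -- With `μ = (4/k)^(2/3)`, the product `(V₀/λ)^(2/3) μ` is `(4V₀/(λk))^(2/3)`, the amplitude.
    rw [hnorm, ← Real.mul_rpow (by positivity) (by positivity), amplitude]
    congr 2
    field_simp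
  · obtain ⟨U, hU, huniq, hd1, hd2, hnorm⟩ := exists_unique_positive hV₀ hR (lamStar_pos hR)
      (k := 1) ⟨one_pos, le_rfl⟩ (flatRadius_lamStar hR)
    refine ⟨U, hU, huniq, by simpa using hd1, by simpa using hd2, ?_⟩
    rw [hnorm, amplitude, mul_one]
  · subst hlamω
    have hω : 1 < ω := (lt_mul_iff_one_lt_right (lamStar_pos hR)).1 hlt
    have hω0 : 0 < ω := one_pos.trans hω
    have hlam := mul_pos (lamStar_pos hR) hω0
    have hs := Real.sqrt_pos.2 hω0
    have hfam := bumpFamily_eq_flatFamily hV₀ hR hω0 hW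
    refine ⟨support_bump_subset_iff hV₀ hR hω0 hW, fun z hz =>
      ⟨isNonnegSolution_bump hV₀ hR hω0 hW hz, support_bump hV₀ hR hω0 hW z, ?_⟩,
      fun j _ => bumpFamily_nonempty_iff hV₀ hR hω0 hW j, fun j hj u hu => ?_,
      fun j _ hjω => ?_, isNonnegSolution_nontrivial_iff hV₀ hR hω hW⟩
    · rw [tsupport, support_bump hV₀ hR hω0 hW, closure_Ioo]
      have : (z - R) / √ω < (z + R) / √ω := by gcongr; linarith
      exact this.ne
    · rw [hfam] at hu
      have hnorm := supNorm_of_mem_flatFamily hV₀ hlam hj hu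
      rw [amplitude_mul hV₀ hR hω0] at hnorm
      refine ⟨isNonnegSolution_of_mem_flatFamily hV₀ hlam hu,
        hasCompactSupport_of_mem_flatFamily hV₀ hlam hu,
        card_components_of_mem_flatFamily hV₀ hlam hu, ?_, ?_⟩
      · rw [hnorm, supNorm_critical hV₀ hR hW, ENNReal.ofReal_mul (by positivity)]
      · rw [hnorm, amplitude, mul_one]
    · rw [hfam]
      exact exists_mem_flatFamily_tsupport hV₀ hlam hR ((mul_div_sqrt_lt_iff hR hω0 j).2 hjω)
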